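/- Let $p$ be a prime. For a field $K$ of characteristic $p$ and a $K$-vector space $V$ write $V^{(p)} = K\otimes_{\mathrm{Frob},K} V$ for its Frobenius twist. An *$F$-zip* over $K$ is a finite-dimensional $K$-vector space $M$ with a descending filtration $(C^i)_{i\in\mathbb Z}$ and an ascending filtration $(D_i)_{i\in\mathbb Z}$ by subspaces (with $C^i=M$, $D_i=0$ for $i\ll 0$ and $C^i=0$, $D_i=M$ for $i\gg 0$), together with $K$-linear isomorphisms $\varphi_i\colon (C^i/C^{i+1})^{(p)} \to D_i/D_{i-1}$ for all $i\in\mathbb Z$. An isomorphism of $F$-zips is a linear isomorphism that respects both filtrations and is compatible with the $\varphi_i$. The *type* of $M$ is the function $\tau\colon\mathbb Z\to\mathbb Z_{\ge 0}$, $\tau(i)=\dim_K (C^i/C^{i+1})$. Let $\tau\colon \mathbb Z\to\mathbb Z_{\ge0}$ be a function with finite support $i_1<\dots<i_r$; put $n_j=\tau(i_j)$, $m_j=n_1+\dots+n_j$, $n=m_r$ ($n = 0$ is allowed). Let $W=S_n$ and let $W_J=S_{n_r}\times\dots\times S_{n_1}\subset S_n$ be the subgroup of permutations preserving each of the blocks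 $\{n-m_j+1,\dots,n-m_{j-1}\}$, $1\le j\le r$. Let ${}^JW$ be the set of $u\in S_n$ such that $u^{-1}(n-m_j+1)<\dots<u^{-1}(n-m_{j-1})$ for all $j$. Let $x\in S_n$ be given by $x(a)=a+m_j+m_{j-1}-n$ for $n-m_j<a\le n-m_{j-1}$. For $u\in{}^JW$ let the *standard $F$-zip* $\underline M^u_\tau$ over $\mathbb F_p$ have underlying space $\mathbb F_p^n$ with standard basis $e_1,\dots,e_n$, filtrations that jump only at the indices in the support of $\tau$ and are given there by $$C^{i_j}=\langle e_a : u(a)\le n-m_{j-1}\rangle,\qquad D_{i_j}=\langle e_b : b\le m_j\rangle ,$$ and isomorphisms $\varphi_{i_j}$ sending $1\otimes[e_a]$ to $[e_{x(u(a))}]$ for all $a$ with $n-m_j<u(a)\le n-m_{j-1}$ (and $\varphi_i=0$ between zero spaces for $i$ outside the support). **Theorem.** Let $k$ be an algebraically closed field of characteristic $p$. Then: 1. for every $u\in{}^JW$ the $F$-zip $\underline M^u_\tau$ over $\mathbb F_p$ has type $\tau$; 2. $u\mapsto \underline M^u_\tau\otimes_{\mathbb F_p}k$ induces a bijection from ${}^JW$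 onto the set of isomorphism classes of $F$-zips of type $\tau$ over $k$; 3. $u\mapsto W_Ju$ is a bijection ${}^JW\to W_J\backslash S_n$; 4. in particular, every $F$-zip of type $\tau$ over $k$ is isomorphic to $\underline M^u_\tau\otimes_{\mathbb F_p}k$ for a unique $u\in{}^JW$. -/

import Mathlib

open scoped TensorProduct

universe u v w

noncomputable section

/-! ## Frobenius twists -/

section Twist

variable (p : ℕ) [Fact p.Prime]

/-- The field `K`, regarded as a `K`-algebra through the Frobenius `x ↦ x ^ p`. -/
def FrobAlg (_p : ℕ) (K : Type u) : Type u := K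

instance (K : Type u) [Field K] : Field (FrobAlg p K) := inferInstanceAs (Field K)

instance (K : Type u) [Field K] [CharP K p] : Algebra K (FrobAlg p K) :=
  RingHom.toAlgebra (S := FrobAlg p K) (frobenius K p)

/-- The Frobenius twist `V^(p) = K ⊗_{K, Frob} V` of a `K`-vector space `V`. -/
def FrobTwist (K : Type u) [Field K] [CharP K p] (V : Type v) [AddCommGroup V] [Module K V] :
    Type (max u v) :=
  FrobAlg p K ⊗[K] V

variable {K : Type u} [Field K] [CharP K p]
variable {V : Type v} [AddCommGroup V] [Module K V] {V' : Type w} [AddCommGroup V'] [Module K V']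

instance : AddCommGroup (FrobTwist p K V) := inferInstanceAs (AddCommGroup (FrobAlg p K ⊗[K] V))

/-- `K` acts on `K ⊗_{K, Frob} V` by multiplication on the left factor. -/
instance : Module K (FrobTwist p K V) :=
  inferInstanceAs (Module (FrobAlg p K) (FrobAlg p K ⊗[K] V))

namespace FrobTwist

/-- The canonical Frobenius-semilinear map `V → V^(p)`, `v ↦ 1 ⊗ v`. -/
def mk : V →ₛₗ[frobenius K p] FrobTwist p K V where
  toFun v := ((1 : FrobAlg p K) ⊗ₜ[K] v : FrobAlg p K ⊗[K] V)
  map_add' a b := TensorProduct.tmul_add _ a b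
  map_smul' c a := by
    change (1 : FrobAlg p K) ⊗ₜ[K] (c • a) =
      (show FrobAlg p K from frobenius K p c) • ((1 : FrobAlg p K) ⊗ₜ[K] a)
    rw [TensorProduct.tmul_smul, TensorProduct.smul_tmul', TensorProduct.smul_tmul',
      Algebra.smul_def, smul_eq_mul]
    rfl

theorem induction_on {P : FrobTwist p K V → Prop} (x : FrobTwist p K V)
    (h0 : P 0) (h1 : ∀ (c : K) (v : V), P (c • mk p v)) (h2 : ∀ x y, P x → P y → P (x + y)) :
    P x := by
  refine TensorProduct.induction_on (motive := P) x h0 (fun c v => ?_) h2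
  have : (c ⊗ₜ[K] v : FrobAlg p K ⊗[K] V) = c • ((1 : FrobAlg p K) ⊗ₜ[K] v) := by
    rw [TensorProduct.smul_tmul', smul_eq_mul, mul_one]
  rw [this]
  exact h1 c v

/-- The additive map underlying the linearization of a Frobenius-semilinear map. -/
def liftAux (f : V →ₛₗ[frobenius K p] V') : FrobTwist p K V →+ V' :=
  TensorProduct.liftAddHom (R := K) (M := FrobAlg p K) (N := V) (P := V')
    (show K →+ V →+ V' from (smulAddHom K V').compl₂ f.toAddMonoidHom)
    (by
      intro r c v
      change (frobenius K p r * (show K from c)) • f v = (show K from c) • f (r • v)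
      rw [f.map_smulₛₗ, smul_smul, mul_comm])

theorem liftAux_smul_mk (f : V →ₛₗ[frobenius K p] V') (c : K) (v : V) :
    liftAux p f (c • mk p v) = c • f v := by
  have key : (c • mk p v : FrobTwist p K V) =
      (show FrobAlg p K ⊗[K] V from (show FrobAlg p K from c) ⊗ₜ[K] v) := by
    change (show FrobAlg p K from c) • ((1 : FrobAlg p K) ⊗ₜ[K] v) = _
    rw [TensorProduct.smul_tmul', smul_eq_mul, mul_one]
  rw [key]
  rfl

/-- The linearization `V^(p) → W`, `c ⊗ v ↦ c • f v`, of a Frobenius-semilinear map `f : V → W`. -/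
def lift (f : V →ₛₗ[frobenius K p] V') : FrobTwist p K V →ₗ[K] V' where
  toFun := liftAux p f
  map_add' := map_add _
  map_smul' c x := by
    induction x using FrobTwist.induction_on with
    | h0 => rw [smul_zero, map_zero, smul_zero]
    | h2 x y hx hy => rw [smul_add, map_add, map_add, smul_add, hx, hy]
    | h1 d v => rw [smul_smul, liftAux_smul_mk, liftAux_smul_mk, RingHom.id_apply, mul_smul]

@[simp] theorem lift_mk (f : V →ₛₗ[frobenius K p] V') (v : V) : lift p f (mk p v) = f v :=
  one_smul K (f v)

theorem hom_ext {f g : FrobTwist p K V →ₗ[K] V'} (h : ∀ v, f (mk p v) = g (mk p v)) : f = g := by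
  ext x
  induction x using FrobTwist.induction_on with
  | h0 => simp
  | h1 c v => simp [h]
  | h2 x y hx hy => simp [hx, hy]

/-- Functoriality of the Frobenius twist: `f^(p) = id ⊗ f`. -/
def map (f : V →ₗ[K] V') : FrobTwist p K V →ₗ[K] FrobTwist p K V' :=
  lift p ((mk p).comp f)

@[simp] theorem map_mk (f : V →ₗ[K] V') (v : V) : map p f (mk p v) = mk p (f v) := by
  simp [map]

theorem map_map {V'' : Type*} [AddCommGroup V''] [Module K V''] (f : V →ₗ[K] V')
    (g : V' →ₗ[K] V'') (x : FrobTwist p K V) : map p g (map p f x) = map p (g ∘ₗ f) x :=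
  LinearMap.congr_fun (hom_ext p (f := map p g ∘ₗ map p f) (by simp)) x

theorem map_id (x : FrobTwist p K V) : map p (LinearMap.id : V →ₗ[K] V) x = x :=
  LinearMap.congr_fun (hom_ext p (g := LinearMap.id) (by simp)) x

/-- A linear equivalence induces one of Frobenius twists. -/
def congr (e : V ≃ₗ[K] V') : FrobTwist p K V ≃ₗ[K] FrobTwist p K V' :=
  LinearEquiv.ofLinearMap (map p e.toLinearMap) (map p e.symm.toLinearMap)
    (hom_ext p (by simp)) (hom_ext p (by simp))

/-- The canonical isomorphism `(K^ι)^(p) ≃ K^ι`, `c ⊗ v ↦ c v^p` (coordinatewise power). -/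
def piEquiv (ι : Type*) [Fintype ι] : FrobTwist p K (ι → K) ≃ₗ[K] (ι → K) := by
  classical
  exact LinearEquiv.ofLinearMap
    (lift p
      { toFun := fun v i => frobenius K p (v i)
        map_add' := by intro a b; ext i; simp only [Pi.add_apply, map_add]
        map_smul' := by intro c a; ext i; simp only [Pi.smul_apply, smul_eq_mul, map_mul] })
    (Fintype.linearCombination K fun i => mk p (Pi.single i (1 : K)))
    (by
      ext i j
      by_cases h : i = j
      · subst h; simp
      · simp [h])
    (by
      refine hom_ext p fun v => ?_
      simp only [LinearMap.comp_apply, lift_mk, LinearMap.id_apply]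
      change ∑ i, frobenius K p (v i) • mk p (Pi.single i (1 : K)) = _
      have hv : v = ∑ i, v i • (Pi.single i (1 : K) : ι → K) := by
        ext j; simp [Finset.sum_apply, Pi.single_apply]
      conv_rhs => rw [hv, map_sum]
      refine Finset.sum_congr rfl fun i _ => ?_
      rw [LinearMap.map_smulₛₗ])

section BaseChange

variable (L : Type w) [Field L] [CharP L p] [Algebra K L]

theorem frobenius_algebraMap' (c : K) :
    frobenius L p (algebraMap K L c) = algebraMap K L (frobenius K p c) := by
  simp [frobenius_def]

/-- The semilinear map `L ⊗ V → L ⊗ V^(p)`, `a ⊗ v ↦ a ^ p ⊗ (1 ⊗ v)`. -/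
def baseChangeAux : L ⊗[K] V →ₛₗ[frobenius L p] L ⊗[K] FrobTwist p K V where
  toFun := TensorProduct.liftAddHom (R := K) (M := L) (N := V) (P := L ⊗[K] FrobTwist p K V)
    { toFun := fun a =>
        { toFun := fun v => frobenius L p a ⊗ₜ[K] mk p v
          map_zero' := by simp
          map_add' := by intro x y; rw [map_add, TensorProduct.tmul_add] }
      map_zero' := by ext v; simp
      map_add' := by
        intro a b; ext v
        simp only [map_add, TensorProduct.add_tmul, AddMonoidHom.coe_mk, ZeroHom.coe_mk,
          AddMonoidHom.add_apply] }
    (by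
      intro r a v
      simp only [AddMonoidHom.coe_mk, ZeroHom.coe_mk]
      rw [Algebra.smul_def, map_mul, frobenius_algebraMap', ← Algebra.smul_def,
        LinearMap.map_smulₛₗ, TensorProduct.smul_tmul])
  map_add' := map_add _
  map_smul' c x := by
    induction x using TensorProduct.induction_on with
    | zero => simp
    | add x y hx hy => simp only [smul_add, map_add, hx, hy]
    | tmul a v =>
      simp only [TensorProduct.smul_tmul', TensorProduct.liftAddHom_tmul, AddMonoidHom.coe_mk,
        ZeroHom.coe_mk, smul_eq_mul, map_mul]

@[simp] theorem baseChangeAux_tmul (a : L) (v : V) :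
    baseChangeAux p L (a ⊗ₜ[K] v) = (a ^ p) ⊗ₜ[K] mk p v := rfl

/-- The canonical isomorphism `(L ⊗ V)^(p) ≃ L ⊗ V^(p)`, `1 ⊗ (a ⊗ v) ↦ a ^ p ⊗ (1 ⊗ v)`. -/
def baseChange : FrobTwist p L (L ⊗[K] V) ≃ₗ[L] L ⊗[K] FrobTwist p K V := by
  letI : Module K (FrobTwist p L (L ⊗[K] V)) := Module.compHom _ (algebraMap K L)
  haveI : IsScalarTower K L (FrobTwist p L (L ⊗[K] V)) :=
    ⟨fun a b c => by rw [Algebra.smul_def, mul_smul]; rfl⟩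
  let g : V →ₛₗ[frobenius K p] FrobTwist p L (L ⊗[K] V) :=
    { toFun := fun v => mk p ((1 : L) ⊗ₜ[K] v)
      map_add' := by intro a b; rw [TensorProduct.tmul_add, map_add]
      map_smul' := by
        intro c v
        have h : (1 : L) ⊗ₜ[K] (c • v) = algebraMap K L c • ((1 : L) ⊗ₜ[K] v) := by
          rw [← TensorProduct.smul_tmul, Algebra.smul_def, TensorProduct.smul_tmul', smul_eq_mul]
        rw [h, LinearMap.map_smulₛₗ, frobenius_algebraMap']
        rfl }
  exact LinearEquiv.ofLinearMap (lift p (baseChangeAux p L)) ((lift p g).liftBaseChange L)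
    (by
      have h1 : ∀ (a : L) (v : V), lift p (baseChangeAux p L)
          ((lift p g).liftBaseChange L (a ⊗ₜ[K] mk p v)) = a ⊗ₜ[K] mk p v := by
        intro a v
        rw [LinearMap.liftBaseChange_tmul, lift_mk, LinearMap.map_smul]
        change a • lift p (baseChangeAux p L) (mk p ((1 : L) ⊗ₜ[K] v)) = _
        rw [lift_mk, baseChangeAux_tmul, one_pow, TensorProduct.smul_tmul', smul_eq_mul, mul_one]
      ext x
      simp only [TensorProduct.AlgebraTensorModule.curry_apply,
        TensorProduct.curry_apply, LinearMap.comp_apply, LinearMap.id_apply,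
        LinearMap.coe_restrictScalars]
      induction x using FrobTwist.induction_on with
      | h0 => rw [TensorProduct.tmul_zero, map_zero, map_zero]
      | h2 x y hx hy => rw [TensorProduct.tmul_add, map_add, map_add, hx, hy]
      | h1 c v => rw [← TensorProduct.smul_tmul, h1])
    (by
      refine hom_ext p fun x => ?_
      induction x using TensorProduct.induction_on with
      | zero => simp
      | add x y hx hy => rw [map_add, map_add, map_add, hx, hy]
      | tmul a v =>
        simp only [LinearMap.comp_apply, lift_mk, baseChangeAux_tmul,
          LinearMap.liftBaseChange_tmul, LinearMap.id_apply]
        have h : a ⊗ₜ[K] v = a • ((1 : L) ⊗ₜ[K] v) := by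
          rw [TensorProduct.smul_tmul', smul_eq_mul, mul_one]
        rw [h, LinearMap.map_smulₛₗ]
        rfl)

end BaseChange

end FrobTwist

end Twist

/-! ## Subquotients of filtrations -/

section Subquotient

variable {K : Type u} [Field K] {V : Type v} [AddCommGroup V] [Module K V]
variable {V' : Type w} [AddCommGroup V'] [Module K V']

/-- The subquotient `A / B` for subspaces `B ⊆ A`. -/
abbrev Subquot (A B : Submodule K V) : Type v := ↥A ⧸ B.submoduleOf A

/-- The map `A / B → A' / B'` induced by a linear map `f` with `f A ⊆ A'` and `f B ⊆ B'`. -/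
def Subquot.map {A B : Submodule K V} {A' B' : Submodule K V'} (f : V →ₗ[K] V')
    (hA : ∀ x ∈ A, f x ∈ A') (hB : ∀ x ∈ B, f x ∈ B') : Subquot A B →ₗ[K] Subquot A' B' :=
  Submodule.mapQ _ _ (f.restrict hA) fun x hx => hB x hx

@[simp] theorem Subquot.map_mk {A B : Submodule K V} {A' B' : Submodule K V'} (f : V →ₗ[K] V')
    (hA : ∀ x ∈ A, f x ∈ A') (hB : ∀ x ∈ B, f x ∈ B') (x : A) :
    Subquot.map f hA hB (Submodule.Quotient.mk x) = Submodule.Quotient.mk ⟨f x, hA x x.2⟩ := rfl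

/-- The canonical surjection `L ⊗ A → L ⊗ (A / B)`, with `L ⊗ A` regarded as a subspace of
`L ⊗ V`. -/
def Subquot.baseChangeProj (L : Type w) [Field L] [Algebra K L] (A B : Submodule K V) :
    A.baseChange L →ₗ[L] L ⊗[K] Subquot A B :=
  (B.submoduleOf A).mkQ.baseChange L ∘ₗ
    (Submodule.toBaseChange.toLinearEquiv L A).symm.toLinearMap

theorem Subquot.baseChangeProj_surjective (L : Type w) [Field L] [Algebra K L]
    (A B : Submodule K V) : Function.Surjective (Subquot.baseChangeProj L A B) :=
  (LinearMap.lTensor_surjective L (Submodule.mkQ_surjective _)).comp (LinearEquiv.surjective _)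

theorem Subquot.toBaseChange_baseChange_inclusion (L : Type w) [Field L] [Algebra K L]
    {A B : Submodule K V} (h : B ≤ A) (z : L ⊗[K] B) :
    ((A.toBaseChange L ((Submodule.inclusion h).baseChange L z) : A.baseChange L) : L ⊗[K] V) =
      (B.toBaseChange L z : B.baseChange L) := by
  induction z using TensorProduct.induction_on with
  | zero => simp
  | add x y hx hy => simp only [map_add, Submodule.coe_add, hx, hy]
  | tmul a x => rfl

theorem Subquot.ker_baseChangeProj (L : Type w) [Field L] [Algebra K L]
    {A B : Submodule K V} (h : B ≤ A) :
    LinearMap.ker (Subquot.baseChangeProj L A B) =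
      (B.baseChange L).submoduleOf (A.baseChange L) := by
  have hex : Function.Exact (Submodule.inclusion h) (B.submoduleOf A).mkQ := by
    intro x
    rw [Submodule.mkQ_apply, Submodule.Quotient.mk_eq_zero]
    exact ⟨fun hx => ⟨⟨x, hx⟩, rfl⟩, by rintro ⟨y, rfl⟩; exact y.2⟩
  have hexL := lTensor_exact L hex (Submodule.mkQ_surjective _)
  ext y
  obtain ⟨z, rfl⟩ := (Submodule.toBaseChange.toLinearEquiv L A).surjective y
  rw [LinearMap.mem_ker, Subquot.baseChangeProj, LinearMap.comp_apply, LinearEquiv.coe_coe,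
    LinearEquiv.symm_apply_apply]
  refine (hexL z).trans ⟨?_, fun hz => ?_⟩
  · rintro ⟨w, rfl⟩
    change ((A.toBaseChange L ((Submodule.inclusion h).baseChange L w) : A.baseChange L) :
      L ⊗[K] V) ∈ B.baseChange L
    rw [Subquot.toBaseChange_baseChange_inclusion]
    exact (B.toBaseChange L w).2
  · obtain ⟨w, hw⟩ := B.toBaseChange_surjective L ⟨_, hz⟩
    refine ⟨w, ?_⟩
    apply (Submodule.toBaseChange.toLinearEquiv L A).injective
    apply Subtype.ext
    have := Subquot.toBaseChange_baseChange_inclusion L h w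
    rw [hw] at this
    exact this

/-- Base change commutes with subquotients: `L ⊗ (A / B) ≃ (L ⊗ A) / (L ⊗ B)`, where
`a ⊗ [x]` corresponds to `[a ⊗ x]`. -/
def Subquot.baseChange (L : Type w) [Field L] [Algebra K L] {A B : Submodule K V} (h : B ≤ A) :
    L ⊗[K] Subquot A B ≃ₗ[L] Subquot (A.baseChange L) (B.baseChange L) :=
  ((Submodule.quotEquivOfEq _ _ (Subquot.ker_baseChangeProj L h).symm).trans
    (LinearMap.quotKerEquivOfSurjective _ (Subquot.baseChangeProj_surjective L A B))).symm

theorem Subquot.baseChange_tmul (L : Type w) [Field L] [Algebra K L] {A B : Submodule K V}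
    (h : B ≤ A) (a : L) (x : A) :
    Subquot.baseChange L h (a ⊗ₜ[K] (Submodule.Quotient.mk x : Subquot A B)) =
      Submodule.Quotient.mk ⟨a ⊗ₜ[K] (x : V), Submodule.tmul_mem_baseChange_of_mem a x.2⟩ := by
  rw [Subquot.baseChange, LinearEquiv.symm_apply_eq]
  change _ = (B.submoduleOf A).mkQ.baseChange L
    ((Submodule.toBaseChange.toLinearEquiv L A).symm
      (Submodule.toBaseChange.toLinearEquiv L A (a ⊗ₜ[K] x)))
  rw [LinearEquiv.symm_apply_apply]
  rfl

end Subquotient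

/-! ## F-zips over a field of characteristic `p` -/

/-- An `F`-zip over a field `K` of characteristic `p`: a finite-dimensional `K`-vector space with a
descending filtration `C`, an ascending filtration `D` (both exhaustive and separated) and
`K`-linear isomorphisms `φ i : (gr^i_C)^(p) ≃ gr_i^D`, where `gr^i_C = C^i / C^{i+1}` and
`gr_i^D = D_i / D_{i-1}`. -/
structure FZip (p : ℕ) [Fact p.Prime] (K : Type u) [Field K] [CharP K p] where
  carrier : Type v
  [addCommGroup : AddCommGroup carrier]
  [module : Module K carrier]
  [finite : Module.Finite K carrier]
  C : ℤ → Submodule K carrier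
  C_succ_le : ∀ i, C (i + 1) ≤ C i
  C_eq_top : ∃ N, ∀ i ≤ N, C i = ⊤
  C_eq_bot : ∃ N, ∀ i ≥ N, C i = ⊥
  D : ℤ → Submodule K carrier
  D_pred_le : ∀ i, D (i - 1) ≤ D i
  D_eq_bot : ∃ N, ∀ i ≤ N, D i = ⊥
  D_eq_top : ∃ N, ∀ i ≥ N, D i = ⊤
  φ : ∀ i, FrobTwist p K (Subquot (C i) (C (i + 1))) ≃ₗ[K] Subquot (D i) (D (i - 1))

namespace FZip

attribute [instance] FZip.addCommGroup FZip.module FZip.finite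

section

variable {p : ℕ} [Fact p.Prime] {K : Type u} [Field K] [CharP K p]

/-- `gr^i_C = C^i / C^{i+1}`. -/
abbrev grC (M : FZip.{u, v} p K) (i : ℤ) : Type v := Subquot (M.C i) (M.C (i + 1))

/-- `gr_i^D = D_i / D_{i-1}`. -/
abbrev grD (M : FZip.{u, v} p K) (i : ℤ) : Type v := Subquot (M.D i) (M.D (i - 1))

/-- `M` has type `τ` if `dim gr^i_C = τ i` for all `i`. -/
def HasType (M : FZip.{u, v} p K) (τ : ℤ →₀ ℕ) : Prop :=
  ∀ i, Module.finrank K (M.grC i) = τ i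

/-- An isomorphism of `F`-zips: a linear isomorphism that carries `C^i` to `C^i` and `D_i` to `D_i`
and whose induced maps on the graded pieces are compatible with the `φ i`. -/
structure Iso (M : FZip.{u, v} p K) (N : FZip.{u, w} p K) where
  toEquiv : M.carrier ≃ₗ[K] N.carrier
  mem_C : ∀ i x, toEquiv x ∈ N.C i ↔ x ∈ M.C i
  mem_D : ∀ i x, toEquiv x ∈ N.D i ↔ x ∈ M.D i
  comm : ∀ i (x : FrobTwist p K (M.grC i)),
    N.φ i (FrobTwist.map p (Subquot.map toEquiv.toLinearMap
        (fun x hx => (mem_C i x).2 hx) (fun x hx => (mem_C (i + 1) x).2 hx)) x) =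
      Subquot.map toEquiv.toLinearMap
        (fun x hx => (mem_D i x).2 hx) (fun x hx => (mem_D (i - 1) x).2 hx) (M.φ i x)

namespace Iso

variable {M : FZip.{u, v} p K} {N : FZip.{u, v} p K} {P : FZip.{u, v} p K}

theorem subquot_id {V : Type v} [AddCommGroup V] [Module K V] {A B : Submodule K V}
    (hA : ∀ x ∈ A, (LinearMap.id : V →ₗ[K] V) x ∈ A)
    (hB : ∀ x ∈ B, (LinearMap.id : V →ₗ[K] V) x ∈ B) :
    Subquot.map LinearMap.id hA hB = LinearMap.id := by
  ext x; rfl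

theorem subquot_comp {V V' V'' : Type v} [AddCommGroup V] [Module K V] [AddCommGroup V']
    [Module K V'] [AddCommGroup V''] [Module K V''] {A B : Submodule K V} {A' B' : Submodule K V'}
    {A'' B'' : Submodule K V''} (f : V →ₗ[K] V') (g : V' →ₗ[K] V'')
    (hA : ∀ x ∈ A, f x ∈ A') (hB : ∀ x ∈ B, f x ∈ B')
    (hA' : ∀ x ∈ A', g x ∈ A'') (hB' : ∀ x ∈ B', g x ∈ B'') :
    Subquot.map g hA' hB' ∘ₗ Subquot.map f hA hB =
      Subquot.map (g ∘ₗ f) (fun x hx => hA' _ (hA x hx)) (fun x hx => hB' _ (hB x hx)) := by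
  ext x; rfl

protected def refl (M : FZip.{u, v} p K) : Iso M M where
  toEquiv := LinearEquiv.refl K _
  mem_C _ _ := Iff.rfl
  mem_D _ _ := Iff.rfl
  comm i x := by
    have h1 : Subquot.map (A := M.C i) (B := M.C (i + 1)) (A' := M.C i) (B' := M.C (i + 1))
        (LinearEquiv.refl K M.carrier).toLinearMap (fun _ h => h) (fun _ h => h) =
        LinearMap.id := subquot_id _ _
    have h2 : Subquot.map (A := M.D i) (B := M.D (i - 1)) (A' := M.D i) (B' := M.D (i - 1))
        (LinearEquiv.refl K M.carrier).toLinearMap (fun _ h => h) (fun _ h => h) =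
        LinearMap.id := subquot_id _ _
    rw [h1, h2, FrobTwist.map_id, LinearMap.id_apply]

protected def trans (e : Iso M N) (f : Iso N P) : Iso M P where
  toEquiv := e.toEquiv.trans f.toEquiv
  mem_C i x := (f.mem_C i _).trans (e.mem_C i x)
  mem_D i x := (f.mem_D i _).trans (e.mem_D i x)
  comm i x := by
    have h := f.comm i (FrobTwist.map p (Subquot.map e.toEquiv.toLinearMap
        (fun x hx => (e.mem_C i x).2 hx) (fun x hx => (e.mem_C (i + 1) x).2 hx)) x)
    rw [e.comm i x, FrobTwist.map_map, ← LinearMap.comp_apply, subquot_comp, subquot_comp] at h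
    exact h

protected def symm (e : Iso M N) : Iso N M where
  toEquiv := e.toEquiv.symm
  mem_C i x := by rw [← e.mem_C, LinearEquiv.apply_symm_apply]
  mem_D i x := by rw [← e.mem_D, LinearEquiv.apply_symm_apply]
  comm i x := by
    have hC : ∀ i, ∀ y ∈ N.C i, e.toEquiv.symm.toLinearMap y ∈ M.C i := fun i y hy => by
      rw [← e.mem_C]; simpa using hy
    have hD : ∀ i, ∀ y ∈ N.D i, e.toEquiv.symm.toLinearMap y ∈ M.D i := fun i y hy => by
      rw [← e.mem_D]; simpa using hy
    have h := e.comm i (FrobTwist.map p (Subquot.map e.toEquiv.symm.toLinearMap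
      (hC i) (hC (i + 1))) x)
    have h' := congrArg (Subquot.map e.toEquiv.symm.toLinearMap (hD i) (hD (i - 1))) h
    rw [FrobTwist.map_map, subquot_comp, ← LinearMap.comp_apply, subquot_comp] at h'
    have k1 : Subquot.map (A := N.C i) (B := N.C (i + 1)) (A' := N.C i) (B' := N.C (i + 1))
        (e.toEquiv.toLinearMap ∘ₗ e.toEquiv.symm.toLinearMap)
        (fun _ h => by simpa using h) (fun _ h => by simpa using h) = LinearMap.id := by
      ext y
      simp
    have k2 : Subquot.map (A := M.D i) (B := M.D (i - 1)) (A' := M.D i) (B' := M.D (i - 1))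
        (e.toEquiv.symm.toLinearMap ∘ₗ e.toEquiv.toLinearMap)
        (fun _ h => by simpa using h) (fun _ h => by simpa using h) = LinearMap.id := by
      ext y
      simp
    rw [k1, k2, FrobTwist.map_id, LinearMap.id_apply] at h'
    exact h'.symm

end Iso

variable (p K) in
/-- The equivalence relation of being isomorphic. -/
def isoSetoid : Setoid (FZip.{u, v} p K) where
  r M N := Nonempty (Iso M N)
  iseqv := ⟨fun M => ⟨Iso.refl M⟩, fun ⟨e⟩ => ⟨e.symm⟩, fun ⟨e⟩ ⟨f⟩ => ⟨e.trans f⟩⟩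

variable (p K) in
/-- Isomorphism classes of `F`-zips over `K`. -/
def IsoClass : Type (max u (v + 1)) := Quotient (isoSetoid.{u, v} p K)

/-- The isomorphism class of an `F`-zip. -/
def isoClass (M : FZip.{u, v} p K) : IsoClass.{u, v} p K := Quotient.mk (isoSetoid p K) M

variable (p K) in
/-- The set of isomorphism classes of `F`-zips of type `τ` over `K`. -/
def isoClassesOfType (τ : ℤ →₀ ℕ) : Set (IsoClass.{u, v} p K) :=
  {c | ∃ M : FZip.{u, v} p K, M.HasType τ ∧ isoClass M = c}

/-- The base change `M ⊗_K L` of an `F`-zip along a field extension. -/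
def baseChange (M : FZip.{u, v} p K) (L : Type w) [Field L] [CharP L p] [Algebra K L] :
    FZip.{w, max v w} p L where
  carrier := L ⊗[K] M.carrier
  C i := (M.C i).baseChange L
  C_succ_le i := Submodule.baseChange_mono L (M.C_succ_le i)
  C_eq_top := M.C_eq_top.imp fun N h i hi => by rw [h i hi, Submodule.baseChange_top]
  C_eq_bot := M.C_eq_bot.imp fun N h i hi => by rw [h i hi, Submodule.baseChange_bot]
  D i := (M.D i).baseChange L
  D_pred_le i := Submodule.baseChange_mono L (M.D_pred_le i)
  D_eq_bot := M.D_eq_bot.imp fun N h i hi => by rw [h i hi, Submodule.baseChange_bot]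
  D_eq_top := M.D_eq_top.imp fun N h i hi => by rw [h i hi, Submodule.baseChange_top]
  φ i := (FrobTwist.congr p (Subquot.baseChange L (M.C_succ_le i)).symm).trans <|
    (FrobTwist.baseChange p L).trans <|
      (LinearEquiv.baseChange K L _ _ (M.φ i)).trans (Subquot.baseChange L (M.D_pred_le i))

end

end FZip

/-! ## The combinatorics of a type

A type is a finitely supported function `τ : ℤ → ℕ`. If its support is `i_1 < ... < i_r`, then put
`n_j = τ i_j`, `m_j = n_1 + ... + n_j` and `n = m_r`. Positions `1, ..., n` are numbered
`0, ..., n - 1` here, and blocks are indexed by the integer `i = i_j` instead of `j`; blocks with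
index outside the support are empty. -/

namespace ZipType

variable (τ : ℤ →₀ ℕ)

/-- `n = ∑ τ i`. -/
def rank : ℕ := ∑ i ∈ τ.support, τ i

/-- `m_{j-1} = n_1 + ... + n_{j-1}` for `i = i_j`. -/
def head (i : ℤ) : ℕ := ∑ j ∈ τ.support with j < i, τ j

/-- `n - m_j = n_{j+1} + ... + n_r` for `i = i_j`. -/
def tail (i : ℤ) : ℕ := ∑ j ∈ τ.support with i < j, τ j

/-- The block `{n - m_j + 1, ..., n - m_{j-1}}` (of length `n_j`), `i = i_j`, of the ordered
partition `J = (n_r, ..., n_1)` of `n`. -/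
def blockJ (i : ℤ) : Set (Fin (rank τ)) := {a | tail τ i ≤ a ∧ (a : ℕ) < tail τ i + τ i}

/-- The block `{m_{j-1} + 1, ..., m_j}` (of length `n_j`), `i = i_j`, of the ordered
partition `(n_1, ..., n_r)` of `n`. -/
def blockK (i : ℤ) : Set (Fin (rank τ)) := {a | head τ i ≤ a ∧ (a : ℕ) < head τ i + τ i}

/-- The subgroup `W_J = S_{n_r} × ... × S_{n_1}` of `S_n`: permutations preserving each block
of the ordered partition `J`. -/
def WJ : Subgroup (Equiv.Perm (Fin (rank τ))) where
  carrier := {w | ∀ i a, w a ∈ blockJ τ i ↔ a ∈ blockJ τ i}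
  mul_mem' hv hw i a := (hv i _).trans (hw i a)
  one_mem' _ _ := Iff.rfl
  inv_mem' {w} hw i a := by rw [← hw, ← Equiv.Perm.mul_apply, mul_inv_cancel, Equiv.Perm.one_apply]

/-- The set `^J W` of those `u ∈ S_n` such that `u⁻¹` is increasing on each block of `J`, i.e. of
the representatives of minimal length of the cosets `W_J u`. -/
def JW : Set (Equiv.Perm (Fin (rank τ))) := {u | ∀ i, StrictMonoOn (⇑u⁻¹) (blockJ τ i)}

theorem tail_succ (i : ℤ) : tail τ (i + 1) + τ (i + 1) = tail τ i := by
  have h : (τ.support.filter fun j => i < j) =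
      (τ.support.filter fun j => i + 1 < j) ∪ (τ.support.filter fun j => j = i + 1) := by
    ext j; simp only [Finset.mem_filter, Finset.mem_union]
    constructor
    · rintro ⟨h1, h2⟩
      rcases eq_or_lt_of_le (show i + 1 ≤ j by omega) with h | h
      · exact Or.inr ⟨h1, h.symm⟩
      · exact Or.inl ⟨h1, h⟩
    · rintro (⟨h1, h2⟩ | ⟨h1, h2⟩) <;> exact ⟨h1, by omega⟩
  rw [tail, tail, h, Finset.sum_union]
  · congr 1
    rw [Finset.sum_filter, Finset.sum_ite_eq']
    by_cases hi : i + 1 ∈ τ.support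
    · rw [if_pos hi]
    · rw [if_neg hi, Finsupp.notMem_support_iff.1 hi]
  · rw [Finset.disjoint_left]
    intro j hj hj'
    have := (Finset.mem_filter.1 hj).2
    have := (Finset.mem_filter.1 hj').2
    omega

theorem head_add_add_tail (i : ℤ) : head τ i + τ i + tail τ i = rank τ := by
  have h : τ.support = ((τ.support.filter fun j => j < i) ∪ (τ.support.filter fun j => j = i)) ∪
      (τ.support.filter fun j => i < j) := by
    ext j; simp only [Finset.mem_filter, Finset.mem_union]
    constructor
    · intro hj
      rcases lt_trichotomy j i with h | h | h
      · exact Or.inl (Or.inl ⟨hj, h⟩)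
      · exact Or.inl (Or.inr ⟨hj, h⟩)
      · exact Or.inr ⟨hj, h⟩
    · rintro ((h | h) | h) <;> exact h.1
  rw [rank, h, Finset.sum_union, Finset.sum_union, head, tail]
  · congr 2
    rw [Finset.sum_filter, Finset.sum_ite_eq']
    by_cases hi : i ∈ τ.support
    · rw [if_pos hi]
    · rw [if_neg hi, Finsupp.notMem_support_iff.1 hi]
  all_goals
    rw [Finset.disjoint_left]
    intro j hj hj'
    simp only [Finset.mem_union, Finset.mem_filter] at hj hj'
    omega

theorem head_pred (i : ℤ) : head τ (i - 1) + τ (i - 1) = head τ i := by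
  have h1 := head_add_add_tail τ i
  have h2 := head_add_add_tail τ (i - 1)
  have h3 := tail_succ τ (i - 1)
  rw [sub_add_cancel] at h3
  omega

theorem tail_anti {i j : ℤ} (h : i ≤ j) : tail τ j ≤ tail τ i :=
  Finset.sum_le_sum_of_subset fun a ha => by
    simp only [Finset.mem_filter] at ha ⊢
    exact ⟨ha.1, by omega⟩

theorem head_mono {i j : ℤ} (h : i ≤ j) : head τ i ≤ head τ j :=
  Finset.sum_le_sum_of_subset fun a ha => by
    simp only [Finset.mem_filter] at ha ⊢
    exact ⟨ha.1, by omega⟩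

theorem blockJ_unique {a : Fin (rank τ)} {i j : ℤ} (hi : a ∈ blockJ τ i) (hj : a ∈ blockJ τ j) :
    i = j := by
  by_contra hne
  obtain ⟨h1, h2⟩ := hi
  obtain ⟨h3, h4⟩ := hj
  rcases lt_or_gt_of_ne hne with h | h
  · have := tail_anti τ (show i + 1 ≤ j by omega)
    have := tail_anti τ (show i ≤ j - 1 by omega)
    have := tail_succ τ (j - 1)
    rw [sub_add_cancel] at this
    omega
  · have := tail_anti τ (show j ≤ i - 1 by omega)
    have := tail_succ τ (i - 1)
    rw [sub_add_cancel] at this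
    omega

theorem blockK_unique {a : Fin (rank τ)} {i j : ℤ} (hi : a ∈ blockK τ i) (hj : a ∈ blockK τ j) :
    i = j := by
  by_contra hne
  obtain ⟨h1, h2⟩ := hi
  obtain ⟨h3, h4⟩ := hj
  rcases lt_or_gt_of_ne hne with h | h
  · have := head_mono τ (show i + 1 ≤ j by omega)
    have := head_pred τ (i + 1)
    rw [add_sub_cancel_right] at this
    omega
  · have := head_mono τ (show j + 1 ≤ i by omega)
    have := head_pred τ (j + 1)
    rw [add_sub_cancel_right] at this
    omega

/-- Beyond the support there is nothing. -/
theorem exists_bounds : ∃ a b : ℤ, ∀ i, τ i ≠ 0 → a < i ∧ i < b := by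
  obtain ⟨b, hb⟩ := τ.support.bddAbove
  obtain ⟨a, ha⟩ := τ.support.bddBelow
  refine ⟨a - 1, b + 1, fun i hi => ?_⟩
  have h := Finsupp.mem_support_iff.2 hi
  have := hb h
  have := ha h
  constructor <;> omega

theorem exists_tail_add_eq_zero : ∃ N : ℤ, ∀ i ≥ N, tail τ i + τ i = 0 := by
  obtain ⟨a, b, h⟩ := exists_bounds τ
  refine ⟨b, fun i hi => ?_⟩
  have h1 : τ i = 0 := by
    by_contra h'
    have := h i h'
    omega
  rw [h1, add_zero, tail]
  refine Finset.sum_eq_zero fun j hj => ?_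
  by_contra h'
  have := h j h'
  have := (Finset.mem_filter.1 hj).2
  omega

theorem exists_head_eq_zero : ∃ N : ℤ, ∀ i ≤ N, head τ i + τ i = 0 := by
  obtain ⟨a, b, h⟩ := exists_bounds τ
  refine ⟨a, fun i hi => ?_⟩
  have h1 : τ i = 0 := by
    by_contra h'
    have := h i h'
    omega
  rw [h1, add_zero, head]
  refine Finset.sum_eq_zero fun j hj => ?_
  by_contra h'
  have := h j h'
  have := (Finset.mem_filter.1 hj).2
  omega

theorem exists_blockJ (a : Fin (rank τ)) : ∃ i, a ∈ blockJ τ i := by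
  obtain ⟨N, hN⟩ := exists_tail_add_eq_zero τ
  obtain ⟨N', hN'⟩ := exists_head_eq_zero τ
  have hex : ∃ z : ℤ, (a : ℕ) < tail τ z + τ z := ⟨N', by
    have h1 := head_add_add_tail τ N'
    have h2 := hN' N' le_rfl
    have := a.2
    omega⟩
  obtain ⟨i, hi, hmax⟩ := Int.exists_greatest_of_bdd
    (P := fun z => (a : ℕ) < tail τ z + τ z)
    ⟨N, fun z hz => by
      by_contra h
      have := hN z (by omega)
      omega⟩ hex
  refine ⟨i, ?_, hi⟩
  by_contra h
  have := tail_succ τ i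
  have := hmax (i + 1) (by omega)
  omega

/-- The index of the block of `J` that contains `a`. -/
def index (a : Fin (rank τ)) : ℤ := (exists_blockJ τ a).choose

theorem index_spec (a : Fin (rank τ)) : a ∈ blockJ τ (index τ a) := (exists_blockJ τ a).choose_spec

theorem mem_blockJ_iff (a : Fin (rank τ)) (i : ℤ) : a ∈ blockJ τ i ↔ index τ a = i :=
  ⟨fun h => blockJ_unique τ (index_spec τ a) h, fun h => h ▸ index_spec τ a⟩

/-- The map `a ↦ a + m_j + m_{j-1} - n` for `n - m_j < a ≤ n - m_{j-1}`. -/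
def xFun (a : Fin (rank τ)) : Fin (rank τ) :=
  ⟨a - tail τ (index τ a) + head τ (index τ a), by
    have h := index_spec τ a
    have h1 := h.1
    have h2 := h.2
    have := head_add_add_tail τ (index τ a)
    omega⟩

theorem xFun_mem (a : Fin (rank τ)) : xFun τ a ∈ blockK τ (index τ a) := by
  have h := index_spec τ a
  have h1 := h.1
  have h2 := h.2
  refine ⟨?_, ?_⟩ <;> simp only [xFun] <;> omega

theorem xFun_injective : Function.Injective (xFun τ) := by
  intro a b h
  have hi : index τ a = index τ b := blockK_unique τ (xFun_mem τ a) (h ▸ xFun_mem τ b)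
  have ha := (index_spec τ a).1
  have hb := (index_spec τ b).1
  have h' := congrArg Fin.val h
  simp only [xFun] at h'
  rw [hi] at h' ha
  exact Fin.ext (by omega)

/-- The permutation `x`, which translates each block of `J = (n_r, ..., n_1)` onto the block of
`(n_1, ..., n_r)` with the same index. -/
def x : Equiv.Perm (Fin (rank τ)) :=
  Equiv.ofBijective (xFun τ) (Finite.injective_iff_bijective.1 (xFun_injective τ))

theorem x_mem_iff (a : Fin (rank τ)) (i : ℤ) : x τ a ∈ blockK τ i ↔ a ∈ blockJ τ i := by
  rw [mem_blockJ_iff]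
  exact ⟨fun h => blockK_unique τ (xFun_mem τ a) h, fun h => h ▸ xFun_mem τ a⟩

/-- The set of those `a` with `u a ≤ n - m_{j-1}`, i.e. `u⁻¹ {1, ..., n - m_{j-1}}`, `i = i_j`. -/
def setC (u : Equiv.Perm (Fin (rank τ))) (i : ℤ) : Set (Fin (rank τ)) :=
  {a | (u a : ℕ) < tail τ i + τ i}

/-- The set `{1, ..., m_j}`, `i = i_j`. -/
def setD (i : ℤ) : Set (Fin (rank τ)) := {b | (b : ℕ) < head τ i + τ i}

/-- The bijection `u⁻¹ {n - m_j + 1, ..., n - m_{j-1}} ≃ {m_{j-1} + 1, ..., m_j}` given by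
`a ↦ x (u a)`. -/
def stdEquiv (u : Equiv.Perm (Fin (rank τ))) (i : ℤ) :
    ↥(setC τ u i \ setC τ u (i + 1)) ≃ ↥(setD τ i \ setD τ (i - 1)) :=
  (u.trans (x τ)).subtypeEquiv fun a => by
    have h1 : a ∈ setC τ u i \ setC τ u (i + 1) ↔ u a ∈ blockJ τ i := by
      have := tail_succ τ i
      simp only [setC, Set.mem_sdiff, Set.mem_ofPred_eq, blockJ, this]
      omega
    have h2 : x τ (u a) ∈ setD τ i \ setD τ (i - 1) ↔ x τ (u a) ∈ blockK τ i := by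
      have := head_pred τ i
      simp only [setD, Set.mem_sdiff, Set.mem_ofPred_eq, blockK, this]
      omega
    rw [h1, ← x_mem_iff, Equiv.trans_apply, h2]

end ZipType

/-! ## Standard `F`-zips -/

section Coordinate

variable (K : Type u) [Field K] {ι : Type v}

/-- The subspace `K^S` of `K^ι` spanned by the basis vectors `e_a`, `a ∈ S`. -/
def coordSub (S : Set ι) : Submodule K (ι → K) where
  carrier := {f | ∀ a ∉ S, f a = 0}
  add_mem' hf hg a ha := by rw [Pi.add_apply, hf a ha, hg a ha, add_zero]
  zero_mem' _ _ := rfl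
  smul_mem' c f hf a ha := by rw [Pi.smul_apply, hf a ha, smul_zero]

theorem coordSub_mono {S T : Set ι} (h : T ⊆ S) : coordSub K T ≤ coordSub K S :=
  fun _ hf a ha => hf a fun h' => ha (h h')

theorem coordSub_univ : coordSub K (Set.univ : Set ι) = ⊤ :=
  eq_top_iff.2 fun _ _ a ha => absurd (Set.mem_univ a) ha

theorem coordSub_empty : coordSub K (∅ : Set ι) = ⊥ :=
  eq_bot_iff.2 fun _ hf => (Submodule.mem_bot K).2 (funext fun a => hf a (Set.notMem_empty a))

/-- The map `K^S → K^(S \ T)` that forgets the coordinates in `T`. -/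
def coordProj (S T : Set ι) : coordSub K S →ₗ[K] (↥(S \ T) → K) :=
  LinearMap.funLeft K K (Subtype.val : ↥(S \ T) → ι) ∘ₗ (coordSub K S).subtype

theorem coordProj_surjective (S T : Set ι) : Function.Surjective (coordProj K S T) := by
  classical
  intro g
  refine ⟨⟨fun a => if h : a ∈ S \ T then g ⟨a, h⟩ else 0, fun a ha => ?_⟩, ?_⟩
  · exact dif_neg fun h => ha h.1
  · ext a
    exact dif_pos a.2

theorem ker_coordProj (S T : Set ι) :
    (coordSub K T).submoduleOf (coordSub K S) = LinearMap.ker (coordProj K S T) := by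
  ext f
  rw [LinearMap.mem_ker]
  constructor
  · intro hf
    ext a
    exact hf a a.2.2
  · intro hf a ha
    by_cases hS : a ∈ S
    · exact congrFun hf ⟨a, hS, ha⟩
    · exact f.2 a hS

/-- The identification `K^S / K^T = K^(S \ T)`, `[f] ↦ f|_(S \ T)`. -/
def coordSubquot (S T : Set ι) : Subquot (coordSub K S) (coordSub K T) ≃ₗ[K] (↥(S \ T) → K) :=
  (Submodule.quotEquivOfEq _ _ (ker_coordProj K S T)).trans
    (LinearMap.quotKerEquivOfSurjective _ (coordProj_surjective K S T))

end Coordinate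

open ZipType in
/-- The standard `F`-zip attached to a type `τ` and a permutation `u` (of interest for `u ∈ ^J W`),
over any field `K` of characteristic `p`; over `𝔽_p` it is denoted `M^u_τ`. The underlying space is
`K^n`. For `i = i_j`, the space `C^i` is spanned by the `e_a` with `u a ∈ {1, ..., n - m_{j-1}}`, the
space `D_i` by the `e_b` with `b ∈ {1, ..., m_j}`, and `φ i` sends `1 ⊗ [e_a]` to `[e_{x (u a)}]`. -/
def stdFZip (p : ℕ) [Fact p.Prime] (K : Type u) [Field K] [CharP K p] (τ : ℤ →₀ ℕ)
    (u : Equiv.Perm (Fin (rank τ))) : FZip.{u, u} p K where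
  carrier := Fin (rank τ) → K
  C i := coordSub K (setC τ u i)
  C_succ_le i := coordSub_mono K fun a (ha : (u a : ℕ) < tail τ (i + 1) + τ (i + 1)) => by
    rw [tail_succ] at ha
    exact Nat.lt_add_right _ ha
  C_eq_top := by
    obtain ⟨N, hN⟩ := exists_head_eq_zero τ
    refine ⟨N, fun i hi => ?_⟩
    rw [← coordSub_univ]
    congr 1
    refine Set.eq_univ_of_forall fun a => ?_
    have h1 := head_add_add_tail τ i
    have h2 := hN i hi
    have h3 := (u a).2
    change (u a : ℕ) < tail τ i + τ i
    omega
  C_eq_bot := by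
    obtain ⟨N, hN⟩ := exists_tail_add_eq_zero τ
    refine ⟨N, fun i hi => ?_⟩
    rw [← coordSub_empty]
    congr 1
    refine Set.eq_empty_of_forall_notMem fun a (ha : (u a : ℕ) < tail τ i + τ i) => ?_
    rw [hN i hi] at ha
    exact Nat.not_lt_zero _ ha
  D i := coordSub K (setD τ i)
  D_pred_le i := coordSub_mono K fun a (ha : (a : ℕ) < head τ (i - 1) + τ (i - 1)) => by
    rw [head_pred] at ha
    exact Nat.lt_add_right _ ha
  D_eq_bot := by
    obtain ⟨N, hN⟩ := exists_head_eq_zero τ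
    refine ⟨N, fun i hi => ?_⟩
    rw [← coordSub_empty]
    congr 1
    refine Set.eq_empty_of_forall_notMem fun a (ha : (a : ℕ) < head τ i + τ i) => ?_
    rw [hN i hi] at ha
    exact Nat.not_lt_zero _ ha
  D_eq_top := by
    obtain ⟨N, hN⟩ := exists_tail_add_eq_zero τ
    refine ⟨N, fun i hi => ?_⟩
    rw [← coordSub_univ]
    congr 1
    refine Set.eq_univ_of_forall fun a => ?_
    have h1 := head_add_add_tail τ i
    have h2 := hN i hi
    have h3 := a.2
    change (a : ℕ) < head τ i + τ i
    omega
  φ i := by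
    classical
    haveI : Fintype ↥(setC τ u i \ setC τ u (i + 1)) := Fintype.ofFinite _
    exact (FrobTwist.congr p (coordSubquot K (setC τ u i) (setC τ u (i + 1)))).trans <|
      (FrobTwist.piEquiv p _).trans <|
        (LinearEquiv.funCongrLeft K K (stdEquiv τ u i).symm).trans
          (coordSubquot K (setD τ i) (setD τ (i - 1))).symm

end

/-! Each `φ i` is encoded by the relation `Rel i x y`, meaning `φ i (1 ⊗ [x]) = [y]`. It is
additive, Frobenius-semilinear, has kernel `C (i + 1)` and indeterminacy `D (i - 1)`. Its image
operator `push i` on subspaces is monotone, with `push i ⊥ = D (i - 1)` and `push i ⊤ = D i`. Hence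
these operators map a chain of subspaces into the successive intervals between `D (i - 1)` and `D
i`.

Suppose a chain contains `0` and is closed under every `push i`. On each step of the chain exactly
one `push i` is strict, and it carries that step onto another step. So the steps carry a label `ι`
and a permutation `π` (`exists_perm`).

Existence. Relating vectors backwards along `π` gives a semilinear operator for the inverse of
Frobenius on a product of subspaces. Over an algebraically closed field such an operator is
nilpotent modulo the span of its fixed vectors (`exists_mem_span_fixed`, a Lang-type statement). Its
fixed vectors are families permuted by the relations (`exists_rel_family`). Adjoining them refines
any closed chain whose steps are not all lines, so a maximal closed chain is a full flag
(`exists_full_flag`). One vector per step then gives a basis with `e a` related to `e (π a)`.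
Counting dimensions of `push i (E t)` shows that `π` is `a ↦ x (u a)` for the `u ∈ ^J W` with block
labels `ι` (`exists_isStdBasis`). Such a basis determines all relations, hence the isomorphism class
(`rel_iff`, `nonempty_iso`).

Uniqueness. The smallest closed chain is intrinsic. In any standard basis its members are spans of
initial basis vectors (`canonical_eq_basisFlag`). The label of the step containing position `a` is
therefore the block of `u a`, and these blocks determine `u ∈ ^J W` (`perm_unique`, `JW_ext`). -/

namespace FrobTwist

/-! ### Elements and dimension of a Frobenius twist. -/

variable (p : ℕ) [Fact p.Prime] {K : Type u} [Field K] [CharP K p]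
variable {V : Type v} [AddCommGroup V] [Module K V]

theorem mk_injective : Function.Injective (mk p : V → FrobTwist p K V) :=
  Module.Flat.tensorProduct_mk_injective (R := K) (FrobAlg p K) (M := V)

/-- Scalars have `p`-th roots, so they can be moved into `V`. This lets relations between vectors
replace maps on the twist. -/
theorem mk_surjective [PerfectRing K p] : Function.Surjective (mk p : V → FrobTwist p K V) := by
  intro x
  induction x using FrobTwist.induction_on with
  | h0 => exact ⟨0, map_zero _⟩
  | h1 c v =>
    obtain ⟨d, rfl⟩ := surjective_frobenius K p c
    exact ⟨d • v, by rw [LinearMap.map_smulₛₗ]⟩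
  | h2 x y hx hy =>
    obtain ⟨a, rfl⟩ := hx
    obtain ⟨b, rfl⟩ := hy
    exact ⟨a + b, map_add _ _ _⟩

theorem finrank_eq : Module.finrank K (FrobTwist p K V) = Module.finrank K V :=
  Module.finrank_baseChange (R := FrobAlg p K) (M' := V)

end FrobTwist

theorem finrank_subquot_add {K : Type u} [Field K] {V : Type v} [AddCommGroup V] [Module K V]
    [Module.Finite K V] {A B : Submodule K V} (h : B ≤ A) :
    Module.finrank K (Subquot A B) + Module.finrank K B = Module.finrank K A := by
  rw [← LinearEquiv.finrank_eq (Submodule.submoduleOfEquivOfLe h)]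
  exact Submodule.finrank_quotient_add_finrank _

/-! ### The relations defined by the `φ i`, and the image operators `push i`. -/

namespace FZip

variable {p : ℕ} [Fact p.Prime] {K : Type u} [Field K] [CharP K p]

/-- The relation `φ i (1 ⊗ [x]) = [y]` between vectors `x ∈ C i` and `y ∈ D i` of an `F`-zip. -/
def Rel (M : FZip.{u, v} p K) (i : ℤ) (x y : M.carrier) : Prop :=
  ∃ (hx : x ∈ M.C i) (hy : y ∈ M.D i),
    M.φ i (FrobTwist.mk p (Submodule.Quotient.mk ⟨x, hx⟩)) = Submodule.Quotient.mk ⟨y, hy⟩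

variable {M : FZip.{u, v} p K} {i : ℤ} {x y x' y' : M.carrier}

theorem Rel.mem_C (h : M.Rel i x y) : x ∈ M.C i := h.1

theorem Rel.mem_D (h : M.Rel i x y) : y ∈ M.D i := h.2.1

theorem Rel.add (h : M.Rel i x y) (h' : M.Rel i x' y') : M.Rel i (x + x') (y + y') := by
  obtain ⟨hx, hy, e⟩ := h
  obtain ⟨hx', hy', e'⟩ := h'
  refine ⟨add_mem hx hx', add_mem hy hy', ?_⟩
  have h1 : (Submodule.Quotient.mk ⟨x + x', add_mem hx hx'⟩ : M.grC i) =
    Submodule.Quotient.mk ⟨x, hx⟩ + Submodule.Quotient.mk ⟨x', hx'⟩ := rfl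
  rw [h1, map_add, map_add, e, e']
  rfl

theorem Rel.smul (h : M.Rel i x y) (c : K) : M.Rel i (c • x) (c ^ p • y) := by
  obtain ⟨hx, hy, e⟩ := h
  refine ⟨Submodule.smul_mem _ _ hx, Submodule.smul_mem _ _ hy, ?_⟩
  have h1 : (Submodule.Quotient.mk ⟨c • x, Submodule.smul_mem _ _ hx⟩ : M.grC i) =
    c • Submodule.Quotient.mk ⟨x, hx⟩ := rfl
  rw [h1, LinearMap.map_smulₛₗ, map_smul, e]
  rfl

theorem Rel.zero (M : FZip.{u, v} p K) (i : ℤ) : M.Rel i 0 0 := by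
  refine ⟨zero_mem _, zero_mem _, ?_⟩
  have h1 : (Submodule.Quotient.mk ⟨0, zero_mem _⟩ : M.grC i) = 0 := rfl
  rw [h1, map_zero, map_zero]
  rfl

theorem Rel.neg (h : M.Rel i x y) : M.Rel i (-x) (-y) := by
  obtain ⟨hx, hy, e⟩ := h
  refine ⟨neg_mem hx, neg_mem hy, ?_⟩
  have h1 : (Submodule.Quotient.mk ⟨-x, neg_mem hx⟩ : M.grC i) =
    - Submodule.Quotient.mk ⟨x, hx⟩ := rfl
  rw [h1, map_neg, map_neg, e]
  rfl

theorem Rel.sub (h : M.Rel i x y) (h' : M.Rel i x' y') : M.Rel i (x - x') (y - y') := by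
  rw [sub_eq_add_neg, sub_eq_add_neg]
  exact h.add h'.neg

theorem Rel.sum {ι : Type*} (s : Finset ι) {f g : ι → M.carrier}
    (h : ∀ a ∈ s, M.Rel i (f a) (g a)) : M.Rel i (∑ a ∈ s, f a) (∑ a ∈ s, g a) := by
  classical
  induction s using Finset.induction_on with
  | empty => simpa using Rel.zero M i
  | insert a s ha ih =>
    rw [Finset.sum_insert ha, Finset.sum_insert ha]
    exact (h a (Finset.mem_insert_self _ _)).add
      (ih fun b hb => h b (Finset.mem_insert_of_mem hb))

theorem exists_rel_right (hx : x ∈ M.C i) : ∃ y, M.Rel i x y := by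
  obtain ⟨⟨y, hy⟩, h⟩ := Submodule.Quotient.mk_surjective _
    (M.φ i (FrobTwist.mk p (Submodule.Quotient.mk ⟨x, hx⟩)))
  exact ⟨y, hx, hy, h.symm⟩

theorem exists_rel_left [PerfectRing K p] (hy : y ∈ M.D i) : ∃ x, M.Rel i x y := by
  obtain ⟨z, hz⟩ := FrobTwist.mk_surjective p ((M.φ i).symm (Submodule.Quotient.mk ⟨y, hy⟩))
  obtain ⟨⟨x, hx⟩, rfl⟩ := Submodule.Quotient.mk_surjective _ z
  exact ⟨x, hx, hy, by rw [hz, LinearEquiv.apply_symm_apply]⟩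

/-- Both `φ i` and `v ↦ 1 ⊗ v` are injective. -/
theorem rel_zero_right : M.Rel i x 0 ↔ x ∈ M.C (i + 1) := by
  have key : ∀ hx : x ∈ M.C i, M.φ i (FrobTwist.mk p (Submodule.Quotient.mk ⟨x, hx⟩)) = 0 ↔
      x ∈ M.C (i + 1) := by
    intro hx
    rw [LinearEquiv.map_eq_zero_iff, map_eq_zero_iff _ (FrobTwist.mk_injective p),
      Submodule.Quotient.mk_eq_zero]
    rfl
  constructor
  · rintro ⟨hx, hy, e⟩
    exact (key hx).1 e
  · intro h
    exact ⟨M.C_succ_le i h, zero_mem _, (key _).2 h⟩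

theorem rel_zero_left : M.Rel i 0 y ↔ y ∈ M.D (i - 1) := by
  have h1 : M.φ i (FrobTwist.mk p (Submodule.Quotient.mk ⟨0, zero_mem (M.C i)⟩)) = 0 := by
    have : (Submodule.Quotient.mk ⟨0, zero_mem _⟩ : M.grC i) = 0 := rfl
    rw [this, map_zero, map_zero]
  constructor
  · rintro ⟨hx, hy, e⟩
    rw [h1] at e
    exact (Submodule.Quotient.mk_eq_zero ((M.D (i - 1)).submoduleOf (M.D i)) (x := ⟨y, hy⟩)).1 e.symm
  · intro h
    exact ⟨zero_mem _, M.D_pred_le i h, h1.trans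
      ((Submodule.Quotient.mk_eq_zero ((M.D (i - 1)).submoduleOf (M.D i))).2 h).symm⟩

theorem Rel.right_unique (h : M.Rel i x y) (h' : M.Rel i x y') : y - y' ∈ M.D (i - 1) := by
  rw [← rel_zero_left]
  simpa using h.sub h'

theorem Rel.left_unique (h : M.Rel i x y) (h' : M.Rel i x' y) : x - x' ∈ M.C (i + 1) := by
  rw [← rel_zero_right]
  simpa using h.sub h'

theorem C_anti (M : FZip.{u, v} p K) : Antitone M.C :=
  antitone_int_of_succ_le M.C_succ_le

theorem D_mono (M : FZip.{u, v} p K) : Monotone M.D :=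
  monotone_int_of_le_succ fun i => by simpa using M.D_pred_le (i + 1)

/-- A linear isomorphism that matches the relations `Rel i` is an isomorphism of `F`-zips. -/
def Iso.ofRel [PerfectRing K p] {M : FZip.{u, v} p K} {N : FZip.{u, w} p K}
    (e : M.carrier ≃ₗ[K] N.carrier)
    (h : ∀ i x y, N.Rel i (e x) (e y) ↔ M.Rel i x y) : M.Iso N where
  toEquiv := e
  -- The relations recover the filtrations: `C i` is the domain of `Rel i`, and `D i` is its range.
  mem_C i x := by
    constructor
    · intro hx
      obtain ⟨y, hy⟩ := exists_rel_right hx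
      obtain ⟨y, rfl⟩ := e.surjective y
      exact ((h i x y).1 hy).mem_C
    · intro hx
      obtain ⟨y, hy⟩ := exists_rel_right hx
      exact ((h i x y).2 hy).mem_C
  mem_D i y := by
    constructor
    · intro hx
      obtain ⟨x, hy⟩ := exists_rel_left hx
      obtain ⟨x, rfl⟩ := e.surjective x
      exact ((h i x y).1 hy).mem_D
    · intro hx
      obtain ⟨x, hy⟩ := exists_rel_left hx
      exact ((h i x y).2 hy).mem_D
  comm i z := by
    obtain ⟨z, rfl⟩ := FrobTwist.mk_surjective p z
    obtain ⟨⟨x, hx⟩, rfl⟩ := Submodule.Quotient.mk_surjective _ z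
    obtain ⟨y, hx, hy, hxy⟩ := exists_rel_right hx
    obtain ⟨hx', hy', hxy'⟩ := (h i x y).2 ⟨hx, hy, hxy⟩
    rw [FrobTwist.map_mk, hxy, Subquot.map_mk, Subquot.map_mk]
    exact hxy'

theorem Iso.rel_iff {M : FZip.{u, v} p K} {N : FZip.{u, w} p K} (e : M.Iso N) (i : ℤ)
    (x y : M.carrier) : N.Rel i (e.toEquiv x) (e.toEquiv y) ↔ M.Rel i x y := by
  have key : ∀ (hx : x ∈ M.C i), N.φ i (FrobTwist.mk p (Submodule.Quotient.mk
      ⟨e.toEquiv x, (e.mem_C i x).2 hx⟩)) = Subquot.map e.toEquiv.toLinearMap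
        (fun x hx => (e.mem_D i x).2 hx) (fun x hx => (e.mem_D (i - 1) x).2 hx)
        (M.φ i (FrobTwist.mk p (Submodule.Quotient.mk ⟨x, hx⟩))) := by
    intro hx
    rw [← e.comm, FrobTwist.map_mk, Subquot.map_mk]
    rfl
  constructor
  · rintro ⟨hx', hy', h⟩
    have hx := (e.mem_C i x).1 hx'
    have hy := (e.mem_D i y).1 hy'
    refine ⟨hx, hy, ?_⟩
    rw [key hx] at h
    obtain ⟨⟨z, hz⟩, hz'⟩ := Submodule.Quotient.mk_surjective _
      (M.φ i (FrobTwist.mk p (Submodule.Quotient.mk ⟨x, hx⟩)))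
    rw [← hz'] at h ⊢
    rw [Subquot.map_mk, Submodule.Quotient.eq] at h
    rw [Submodule.Quotient.eq]
    change e.toEquiv z - e.toEquiv y ∈ N.D (i - 1) at h
    rw [← map_sub, e.mem_D] at h
    exact h
  · rintro ⟨hx, hy, h⟩
    refine ⟨(e.mem_C i x).2 hx, (e.mem_D i y).2 hy, ?_⟩
    rw [key hx, h]
    rfl

section Dimension

variable (M)

theorem finrank_D_eq (i : ℤ) {τ : ℤ →₀ ℕ} (h : M.HasType τ) :
    Module.finrank K (M.D i) = τ i + Module.finrank K (M.D (i - 1)) := by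
  rw [← finrank_subquot_add (M.D_pred_le i), ← LinearEquiv.finrank_eq (M.φ i),
    FrobTwist.finrank_eq]
  exact congrArg (· + _) (h i)

/-- The isomorphisms `φ i` give the graded pieces of `D` the same dimensions as those of `C`;
summation starts far enough down that both sides vanish. -/
theorem finrank_D {τ : ℤ →₀ ℕ} (h : M.HasType τ) (i : ℤ) :
    Module.finrank K (M.D i) = ZipType.head τ i + τ i := by
  obtain ⟨N, hN⟩ := M.D_eq_bot
  obtain ⟨N', hN'⟩ := ZipType.exists_head_eq_zero τ
  have low : ∀ j ≤ min N N', Module.finrank K (M.D j) = ZipType.head τ j + τ j := by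
    intro j hj
    rw [hN j (hj.trans (min_le_left _ _)), hN' j (hj.trans (min_le_right _ _)), finrank_bot]
  rcases le_total i (min N N') with hi | hi
  · exact low i hi
  · induction i, hi using Int.leInduction with
    | base => exact low _ le_rfl
    | succ j hj ih =>
      have := ZipType.head_pred τ (j + 1)
      rw [M.finrank_D_eq (j + 1) h]
      rw [add_sub_cancel_right] at this ⊢
      omega

theorem finrank_carrier {τ : ℤ →₀ ℕ} (h : M.HasType τ) :
    Module.finrank K M.carrier = ZipType.rank τ := by
  obtain ⟨N, hN⟩ := M.D_eq_top
  obtain ⟨N', hN'⟩ := ZipType.exists_tail_add_eq_zero τ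
  have h1 := M.finrank_D h (max N N')
  have h2 := ZipType.head_add_add_tail τ (max N N')
  have h3 := hN' (max N N') (le_max_right _ _)
  rw [hN _ (le_max_left _ _), finrank_top] at h1
  omega

end Dimension

/-- The subspace of those `y` that are related by `Rel i` to some vector of `N`. -/
def push [PerfectRing K p] (M : FZip.{u, v} p K) (i : ℤ) (N : Submodule K M.carrier) :
    Submodule K M.carrier where
  carrier := {y | ∃ x ∈ N, M.Rel i x y}
  add_mem' := by
    rintro _ _ ⟨x, hx, h⟩ ⟨x', hx', h'⟩
    exact ⟨x + x', add_mem hx hx', h.add h'⟩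
  zero_mem' := ⟨0, zero_mem _, Rel.zero M i⟩
  smul_mem' := by
    rintro c _ ⟨x, hx, h⟩
    -- Scaling `x` by `d` scales `y` by `d ^ p`, so closure under scalars needs `p`-th roots.
    obtain ⟨d, rfl⟩ := surjective_frobenius K p c
    exact ⟨d • x, Submodule.smul_mem _ _ hx, h.smul d⟩

variable [PerfectRing K p] {N N' : Submodule K M.carrier}

theorem mem_push : y ∈ M.push i N ↔ ∃ x ∈ N, M.Rel i x y := Iff.rfl

theorem push_mono (h : N ≤ N') : M.push i N ≤ M.push i N' :=
  fun _ ⟨x, hx, hxy⟩ => ⟨x, h hx, hxy⟩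

variable (M i) in
theorem push_bot : M.push i ⊥ = M.D (i - 1) := by
  ext y
  simp [mem_push, rel_zero_left]

variable (M i) in
theorem push_top : M.push i ⊤ = M.D i := by
  ext y
  simp only [mem_push, Submodule.mem_top, true_and]
  exact ⟨fun ⟨x, h⟩ => h.mem_D, exists_rel_left⟩

theorem push_le_D : M.push i N ≤ M.D i := fun _ ⟨_, _, h⟩ => h.mem_D

theorem D_le_push : M.D (i - 1) ≤ M.push i N := by
  rw [← push_bot]
  exact push_mono bot_le

/-- If `Rel i x y` with `y` coming from `N`, then `x ∈ N + C (i + 1)`. -/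
theorem Rel.exists_sub_mem (h : M.Rel i x y) (hy : y ∈ M.push i N) :
    ∃ x' ∈ N, x - x' ∈ M.C (i + 1) := by
  obtain ⟨x', hx', h'⟩ := hy
  exact ⟨x', hx', h.left_unique h'⟩

end FZip

/-! ### Fixed vectors of semilinear operators over an algebraically closed field. -/

section Lang

variable (p : ℕ) [Fact p.Prime] {k : Type u} [Field k]

/-- An additive equation `s ^ (p ^ r) = ∑ l < r, b l * s ^ (p ^ l)` with `b ≠ 0` has a nonzero
solution. -/
theorem exists_ne_zero_additive_eq [IsAlgClosed k] {r : ℕ} (b : ℕ → k)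
    (hb : ∃ l < r, b l ≠ 0) :
    ∃ s : k, s ≠ 0 ∧ s ^ p ^ r = ∑ l ∈ Finset.range r, b l * s ^ p ^ l := by
  classical
  open Polynomial in
  have hp : 1 < p := (Fact.out : p.Prime).one_lt
  set Q : k[X] := ∑ l ∈ Finset.range r, C (b l) * X ^ p ^ l with hQ
  have hQdeg : Q.degree < (p ^ r : ℕ) := by
    refine (degree_sum_le _ _).trans_lt ?_
    rw [Finset.sup_lt_iff (WithBot.bot_lt_coe _)]
    intro l hl
    refine (degree_C_mul_X_pow_le _ _).trans_lt ?_
    exact_mod_cast Nat.pow_lt_pow_right hp (Finset.mem_range.1 hl)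
  have hmonic : (X ^ p ^ r - Q).Monic := monic_X_pow_sub hQdeg
  have hnd : (X ^ p ^ r - Q).natDegree = p ^ r := natDegree_eq_of_degree_eq_some (degree_sub_eq_left_of_degree_lt
      (by rwa [degree_X_pow]) |>.trans (degree_X_pow _))
  -- If `0` were the only root, the monic split polynomial `X ^ p ^ r - Q` would equal `X ^ p ^ r`,
  -- whence `Q = 0`. The exponents `p ^ l` are distinct, so all `b l` would vanish.
  by_contra hcon
  push Not at hcon
  have hroots : ∀ s ∈ (X ^ p ^ r - Q).roots, s = 0 := by
    intro s hs
    by_contra hs0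
    refine hcon s hs0 ?_
    have := (mem_roots'.1 hs).2
    rw [IsRoot.def, eval_sub, eval_pow, eval_X, sub_eq_zero, hQ, eval_finsetSum] at this
    simpa using this
  have hcard : (X ^ p ^ r - Q).roots = Multiset.replicate (p ^ r) 0 := by
    rw [Multiset.eq_replicate]
    refine ⟨?_, hroots⟩
    exact (IsAlgClosed.splits _).natDegree_eq_card_roots.symm.trans hnd
  have hprod := (IsAlgClosed.splits (X ^ p ^ r - Q)).eq_prod_roots_of_monic hmonic
  rw [hcard, Multiset.map_replicate, Multiset.prod_replicate, C_0, sub_zero] at hprod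
  have hQ0 : Q = 0 := by simpa using hprod
  obtain ⟨l, hl, hbl⟩ := hb
  apply hbl
  have h := congrArg (fun P => coeff P (p ^ l)) hQ0
  simp only [hQ, finsetSum_coeff, coeff_C_mul_X_pow, coeff_zero] at h
  rw [Finset.sum_eq_single l] at h
  · simpa using h
  · intro l' _ hne
    exact if_neg fun h => hne ((Nat.pow_right_injective hp) h).symm
  · intro h'
    exact absurd (Finset.mem_range.2 hl) h'

/-- Artin–Schreier: `X ^ p - X + b` has positive degree, hence a root. -/
theorem exists_sub_pow_eq [IsAlgClosed k] (b : k) : ∃ c : k, c - c ^ p = b := by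
  open Polynomial in
  have hp : 1 < p := (Fact.out : p.Prime).one_lt
  have hdeg : (X - C b : k[X]).degree < (X ^ p : k[X]).degree := by
    rw [degree_X_sub_C, degree_X_pow]
    exact_mod_cast hp
  obtain ⟨c, hc⟩ := IsAlgClosed.exists_root (X ^ p - (X - C b) : k[X]) (by
    rw [degree_sub_eq_left_of_degree_lt hdeg, degree_X_pow]
    exact_mod_cast (by omega : p ≠ 0))
  refine ⟨c, ?_⟩
  simp only [IsRoot.def, eval_sub, eval_pow, eval_X, eval_C] at hc
  linear_combination -hc

variable [CharP k p]

/-- The inverse of the Frobenius of a perfect field. -/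
noncomputable abbrev invFrob (k : Type u) [Field k] [CharP k p] [PerfectRing k p] : k →+* k :=
  ((frobeniusEquiv k p).symm : k →+* k)

theorem invFrob_pow [PerfectRing k p] (c : k) : invFrob p k (c ^ p) = c :=
  (frobeniusEquiv k p).symm_apply_apply c

theorem invFrob_pow' [PerfectRing k p] (c : k) : (invFrob p k c) ^ p = c :=
  (frobeniusEquiv k p).apply_symm_apply c

variable {Z : Type v} [AddCommGroup Z] [Module k Z]

/-- Solve for the vector with the last nonzero coefficient. -/
theorem exists_first_relation_lt {h : ℕ → Z} (n : ℕ) (c : ℕ → k)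
    (hc : ∑ j ∈ Finset.range n, c j • h j = 0) (hne : ∃ j < n, c j ≠ 0) :
    ∃ r < n, ∃ a : ℕ → k, h r = ∑ j ∈ Finset.range r, a j • h j := by
  induction n with
  | zero => obtain ⟨j, hj, _⟩ := hne; exact absurd hj (Nat.not_lt_zero j)
  | succ n ih =>
    rw [Finset.sum_range_succ] at hc
    by_cases h0 : c n = 0
    · rw [h0, zero_smul, add_zero] at hc
      obtain ⟨j, hj, hcj⟩ := hne
      have hjn : j ≠ n := fun e => hcj (e ▸ h0)
      obtain ⟨r, hr, h'⟩ := ih hc ⟨j, by omega, hcj⟩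
      exact ⟨r, by omega, h'⟩
    · refine ⟨n, Nat.lt_succ_self n, fun j => -((c n)⁻¹ * c j), ?_⟩
      have e : h n = -((c n)⁻¹ • ∑ j ∈ Finset.range n, c j • h j) := by
        rw [eq_neg_of_add_eq_zero_left hc, smul_neg, neg_neg, smul_smul, inv_mul_cancel₀ h0,
          one_smul]
      rw [e, Finset.smul_sum, ← Finset.sum_neg_distrib]
      exact Finset.sum_congr rfl fun j _ => by rw [neg_smul, smul_smul]

/-- The first linear relation in a sequence of vectors. -/
theorem exists_first_relation [Module.Finite k Z] (h : ℕ → Z) : ∃ (r : ℕ) (a : ℕ → k),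
    (∀ c : ℕ → k, ∑ j ∈ Finset.range r, c j • h j = 0 → ∀ j < r, c j = 0) ∧
      h r = ∑ j ∈ Finset.range r, a j • h j := by
  classical
  have hex : ∃ r, ∃ a : ℕ → k, h r = ∑ j ∈ Finset.range r, a j • h j := by
    have hli := Module.Finite.not_linearIndependent_of_infinite (R := k) h
    rw [linearIndependent_iff'] at hli
    push Not at hli
    obtain ⟨s, g, hg, i, hi, hgi⟩ := hli
    have hle : ∀ j ∈ s, j < s.sup id + 1 := fun j hj =>
      Nat.lt_succ_of_le (Finset.le_sup (f := id) hj)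
    obtain ⟨r, -, h'⟩ := exists_first_relation_lt (h := h) (s.sup id + 1)
      (fun j => if j ∈ s then g j else 0) (by
        rw [← hg]
        simp only [ite_smul, zero_smul]
        rw [← Finset.sum_filter]
        refine Finset.sum_congr ?_ fun _ _ => rfl
        ext j
        simp only [Finset.mem_filter, Finset.mem_range]
        exact ⟨fun h => h.2, fun h => ⟨hle j h, h⟩⟩)
      ⟨i, hle i hi, by simpa [hi] using hgi⟩
    exact ⟨r, h'⟩
  obtain ⟨a, ha⟩ := Nat.find_spec hex
  -- Minimality of `r` gives independence: a nontrivial relation among the first `r` vectors would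
  -- express an earlier one by its predecessors.
  refine ⟨Nat.find hex, a, fun c hc => ?_, ha⟩
  by_contra hcon
  push Not at hcon
  obtain ⟨r, hr, h'⟩ := exists_first_relation_lt (h := h) _ c hc hcon
  exact Nat.find_min hex hr h'

variable [IsAlgClosed k]

/-- A semilinear endomorphism (with respect to the inverse of Frobenius) that is not nilpotent has
a nonzero fixed vector. -/
theorem exists_fixed_ne_zero [Module.Finite k Z] (g : Z →ₛₗ[invFrob p k] Z) (y : Z)
    (hy : ∀ m, g^[m] y ≠ 0) : ∃ w, w ≠ 0 ∧ g w = w := by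
  obtain ⟨r, a, hind, hrel⟩ := exists_first_relation (k := k) fun j => g^[j] y
  -- If all `a l` vanished, the relation would read `g^[r] y = 0`.
  have ha : ∃ l < r, a l ^ p ^ l ≠ 0 := by
    by_contra hcon
    push Not at hcon
    refine hy r (hrel.trans (Finset.sum_eq_zero fun j hj => ?_))
    rw [eq_zero_of_pow_eq_zero (hcon j (Finset.mem_range.1 hj)), zero_smul]
  obtain ⟨s, hs0, hs⟩ := exists_ne_zero_additive_eq p (fun l => a l ^ p ^ l) ha
  have hrpos : 0 < r := by obtain ⟨l, hl, _⟩ := ha; omega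
  -- For `w = ∑ c j • g^[j] y` and `s` the `p`-th root of `c (r - 1)`, the equation `g w = w`
  -- follows from `c 0 = a 0 * s` and from `c (j + 1)` being the `p`-th root of `c j` plus `a (j +
  -- 1) * s`. The solution of this recursion satisfies `c j ^ p ^ j = S j`, and the closing
  -- condition `c (r - 1) = s ^ p` becomes the additive equation solved by `s`.
  set S : ℕ → k := fun j => ∑ l ∈ Finset.range (j + 1), a l ^ p ^ l * s ^ p ^ l with hS
  set c : ℕ → k := fun j => (iterateFrobeniusEquiv k p j).symm (S j) with hcdef
  have hc : ∀ j, c j ^ p ^ j = S j := fun j =>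
    (iterateFrobeniusEquiv k p j).apply_symm_apply (S j)
  have hinj : ∀ (j : ℕ) (x y : k), x ^ p ^ j = y ^ p ^ j → x = y := fun j x y h =>
    (iterateFrobeniusEquiv k p j).injective h
  have hc0 : c 0 = a 0 * s := by simpa [hS] using hc 0
  have hcs : ∀ j, c (j + 1) = invFrob p k (c j) + a (j + 1) * s := by
    intro j
    apply hinj (j + 1)
    rw [hc, add_pow_char_pow, pow_succ' p j, pow_mul (invFrob p k (c j)), invFrob_pow', hc, hS]
    simp only
    rw [Finset.sum_range_succ _ (j + 1), mul_pow, pow_succ' p j]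
  have hlast : c (r - 1) = s ^ p := by
    apply hinj (r - 1)
    rw [hc, ← pow_mul, ← pow_succ', Nat.sub_add_cancel hrpos, hs, hS]
    simp only
    rw [Nat.sub_add_cancel hrpos]
  refine ⟨∑ j ∈ Finset.range r, c j • g^[j] y, fun h0 => ?_, ?_⟩
  · have := hind c h0 (r - 1) (by omega)
    rw [hlast] at this
    exact hs0 (eq_zero_of_pow_eq_zero this)
  · obtain ⟨q, rfl⟩ := Nat.exists_eq_add_of_lt hrpos
    simp only [zero_add] at *
    rw [map_sum]
    simp only [LinearMap.map_smulₛₗ, ← Function.iterate_succ_apply' g]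
    rw [Finset.sum_range_succ, hrel]
    have e : invFrob p k (c q) = s := by
      rw [add_tsub_cancel_right] at hlast
      rw [hlast, invFrob_pow]
    rw [e, Finset.smul_sum, Finset.sum_range_succ' (fun j => c j • _),
      Finset.sum_range_succ' (fun j => s • _), ← add_assoc, ← Finset.sum_add_distrib, hc0]
    congr 1
    · refine Finset.sum_congr rfl fun j _ => ?_
      rw [hcs, add_smul, smul_smul, mul_comm s]
    · rw [smul_smul, mul_comm s]

/-- For a semilinear endomorphism `g` (with respect to the inverse of Frobenius), every vector is
the sum of a linear combination of fixed vectors and of a vector killed by a power of `g`. -/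
theorem exists_mem_span_fixed [Module.Finite k Z] (g : Z →ₛₗ[invFrob p k] Z) (y : Z) :
    ∃ z ∈ Submodule.span k {w | g w = w}, ∃ m, g^[m] (y - z) = 0 := by
  set S := Submodule.span k {w | g w = w} with hS
  have hstab : ∀ z ∈ S, g z ∈ S := by
    intro z hz
    induction hz using Submodule.span_induction with
    | mem w hw => rw [show g w = w from hw]; exact Submodule.subset_span hw
    | zero => rw [map_zero]; exact zero_mem _
    | add _ _ _ _ h1 h2 => rw [map_add]; exact add_mem h1 h2
    | smul c _ _ h => rw [LinearMap.map_smulₛₗ]; exact Submodule.smul_mem _ _ h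
  have hsurj : ∀ z ∈ S, ∃ z' ∈ S, g z' = z := by
    intro z hz
    induction hz using Submodule.span_induction with
    | mem w hw => exact ⟨w, Submodule.subset_span hw, hw⟩
    | zero => exact ⟨0, zero_mem _, map_zero _⟩
    | add _ _ _ _ h1 h2 =>
      obtain ⟨a, ha, rfl⟩ := h1
      obtain ⟨b, hb, rfl⟩ := h2
      exact ⟨a + b, add_mem ha hb, map_add _ _ _⟩
    | smul c _ _ h =>
      obtain ⟨a, ha, rfl⟩ := h
      exact ⟨c ^ p • a, Submodule.smul_mem _ _ ha, by rw [LinearMap.map_smulₛₗ, invFrob_pow]⟩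
  -- `g - 1` is surjective on `S`: on a fixed vector `w`, the multiple `c ^ p • w` goes to `(c - c ^
  -- p) • w`. The free scalar `b` makes the induction pass through scalar multiples.
  have hAS : ∀ z ∈ S, ∀ b : k, ∃ z' ∈ S, g z' - z' = b • z := by
    intro z hz
    induction hz using Submodule.span_induction with
    | zero => exact fun b => ⟨0, zero_mem _, by simp⟩
    | mem w hw =>
      intro b
      obtain ⟨c, hc⟩ := exists_sub_pow_eq p b
      refine ⟨c ^ p • w, Submodule.smul_mem _ _ (Submodule.subset_span hw), ?_⟩
      rw [LinearMap.map_smulₛₗ, invFrob_pow, show g w = w from hw, ← sub_smul, hc]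
    | add _ _ _ _ h1 h2 =>
      intro b
      obtain ⟨x, hx, hx'⟩ := h1 b
      obtain ⟨y, hy, hy'⟩ := h2 b
      exact ⟨x + y, add_mem hx hy, by rw [map_add, smul_add, ← hx', ← hy']; abel⟩
    | smul c _ _ h =>
      intro b
      obtain ⟨x, hx, hx'⟩ := h (b * c)
      exact ⟨x, hx, by rw [hx', mul_smul]⟩
  have hgS : S ≤ S.comap g := hstab
  set gbar : (Z ⧸ S) →ₛₗ[invFrob p k] (Z ⧸ S) := S.mapQ S g hgS with hgbar
  have hmk : ∀ z, gbar (Submodule.Quotient.mk z) = Submodule.Quotient.mk (g z) := fun z => rfl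
  have hit : ∀ m z, gbar^[m] (Submodule.Quotient.mk z) = Submodule.Quotient.mk (g^[m] z) := by
    intro m
    induction m with
    | zero => intro z; rfl
    | succ m ih => intro z; rw [Function.iterate_succ_apply, hmk, ih, Function.iterate_succ_apply]
  -- Otherwise `Z ⧸ S` has a nonzero fixed class `[w]`. Then `g w - w ∈ S` has the form `g z - z`
  -- with `z ∈ S`, so `w - z` is fixed and `w ∈ S`.
  have hnil : ∃ m, g^[m] y ∈ S := by
    by_contra hcon
    push Not at hcon
    obtain ⟨w, hw0, hw⟩ := exists_fixed_ne_zero p gbar (Submodule.Quotient.mk y) fun m h => by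
      rw [hit, Submodule.Quotient.mk_eq_zero] at h
      exact hcon m h
    obtain ⟨w, rfl⟩ := Submodule.Quotient.mk_surjective _ w
    rw [hmk, Submodule.Quotient.eq] at hw
    obtain ⟨z, hz, hz'⟩ := hAS _ hw 1
    rw [one_smul] at hz'
    apply hw0
    rw [Submodule.Quotient.mk_eq_zero]
    have hfix : g (w - z) = w - z := by
      rw [map_sub, ← sub_eq_zero, ← sub_eq_zero.2 hz'.symm]
      abel
    have := add_mem (Submodule.subset_span (R := k) (s := {w | g w = w}) hfix) hz
    rwa [sub_add_cancel] at this
  obtain ⟨m, hm⟩ := hnil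
  have hsurjm : ∀ m, ∀ z ∈ S, ∃ z' ∈ S, g^[m] z' = z := by
    intro m
    induction m with
    | zero => exact fun z hz => ⟨z, hz, rfl⟩
    | succ m ih =>
      intro z hz
      obtain ⟨a, ha, rfl⟩ := ih z hz
      obtain ⟨b, hb, rfl⟩ := hsurj a ha
      exact ⟨b, hb, rfl⟩
  -- Since `g` maps `S` onto itself, `g^[m] y` is also `g^[m] z` for some `z ∈ S`.
  obtain ⟨z, hz, hzm⟩ := hsurjm m _ hm
  exact ⟨z, hz, m, by rw [iterate_map_sub, hzm, sub_self]⟩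

end Lang

theorem Fin.exists_castSucc_succ {s : ℕ} (P : Fin (s + 1) → Prop) (h0 : ¬ P 0)
    (h1 : P (Fin.last s)) : ∃ l : Fin s, ¬ P l.castSucc ∧ P l.succ := by
  by_contra hcon
  push Not at hcon
  exact Fin.induction (motive := fun t => ¬ P t) h0 hcon (Fin.last s) h1

/-- No member of the chain lies strictly between two consecutive ones. -/
theorem StrictMono.le_castSucc_of_not_succ_le {α : Type*} [PartialOrder α] {s : ℕ}
    {E : Fin (s + 1) → α} (hE : StrictMono E) {N : α} (hN : N ∈ Set.range E) {j : Fin s}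
    (h : ¬ E j.succ ≤ N) : N ≤ E j.castSucc := by
  obtain ⟨t, rfl⟩ := hN
  rw [hE.le_iff_le, not_le] at h
  exact hE.monotone (Fin.le_castSucc_iff.2 h)

/-! ### Closed chains and the permutation of their steps. -/

namespace FZip

variable {p : ℕ} [Fact p.Prime] {K : Type u} [Field K] [CharP K p] [PerfectRing K p]

/-- A chain of subspaces of an `F`-zip that contains `0` and is closed under all `push i`. -/
structure IsClosedChain (M : FZip.{u, v} p K) (𝓔 : Set (Submodule K M.carrier)) : Prop where
  chain : IsChain (· ≤ ·) 𝓔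
  bot_mem : ⊥ ∈ 𝓔
  push_mem : ∀ i, ∀ N ∈ 𝓔, M.push i N ∈ 𝓔

variable {M : FZip.{u, v} p K} {𝓔 : Set (Submodule K M.carrier)}

theorem IsClosedChain.D_mem (h : M.IsClosedChain 𝓔) (i : ℤ) : M.D i ∈ 𝓔 := by
  have := h.push_mem (i + 1) _ h.bot_mem
  rwa [push_bot, add_sub_cancel_right] at this

theorem IsClosedChain.top_mem (h : M.IsClosedChain 𝓔) : ⊤ ∈ 𝓔 := by
  obtain ⟨N, hN⟩ := M.D_eq_top
  rw [← hN N le_rfl]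
  exact h.D_mem N

/-- The dimension is injective on a chain, and it is bounded. -/
theorem finite_of_isChain {V : Type v} [AddCommGroup V] [Module K V] [Module.Finite K V]
    {𝓔 : Set (Submodule K V)} (h : IsChain (· ≤ ·) 𝓔) : 𝓔.Finite := by
  refine Set.Finite.of_finite_image (f := fun N => Module.finrank K N)
    ((Set.finite_Iic (Module.finrank K V)).subset ?_) ?_
  · rintro _ ⟨N, -, rfl⟩
    exact Submodule.finrank_le N
  · intro N hN N' hN' e
    rcases h.total hN hN' with h' | h'
    · exact Submodule.eq_of_le_of_finrank_eq h' e
    · exact (Submodule.eq_of_le_of_finrank_eq h' e.symm).symm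

/-- A closed chain is finite, hence can be enumerated in increasing order. -/
theorem IsClosedChain.exists_enum (h : M.IsClosedChain 𝓔) :
    ∃ (s : ℕ) (E : Fin (s + 1) → Submodule K M.carrier), StrictMono E ∧ Set.range E = 𝓔 := by
  classical
  let _ : LinearOrder 𝓔 := h.chain.linearOrder
  have _ : Finite 𝓔 := finite_of_isChain h.chain
  let _ : Fintype 𝓔 := Fintype.ofFinite _
  have hpos : 0 < Fintype.card 𝓔 := Fintype.card_pos_iff.2 ⟨⟨⊥, h.bot_mem⟩⟩
  obtain ⟨s, hs⟩ := Nat.exists_eq_add_of_lt hpos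
  have e := Fintype.orderIsoFinOfCardEq 𝓔 (k := s + 1) (by omega)
  refine ⟨s, fun t => (e t : Submodule K M.carrier), fun a b hab => e.strictMono hab, ?_⟩
  ext N
  constructor
  · rintro ⟨t, rfl⟩
    exact (e t).2
  · intro hN
    exact ⟨e.symm ⟨N, hN⟩, by simp⟩

section Enum

variable {s : ℕ} {E : Fin (s + 1) → Submodule K M.carrier}

theorem IsClosedChain.enum_zero (hE : StrictMono E) (h : M.IsClosedChain (Set.range E)) :
    E 0 = ⊥ := by
  obtain ⟨t, ht⟩ := h.bot_mem
  exact le_bot_iff.1 (ht ▸ hE.monotone (Fin.zero_le t))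

theorem IsClosedChain.enum_last (hE : StrictMono E) (h : M.IsClosedChain (Set.range E)) :
    E (Fin.last s) = ⊤ := by
  obtain ⟨t, ht⟩ := h.top_mem
  exact top_le_iff.1 (ht ▸ hE.monotone (Fin.le_last t))

/-- Every step is reached. With `i` least such that `E j.succ ≤ D i`, the chain `push i (E t)` runs
from `D (i - 1)`, which does not contain `E j.succ`, to `D i`, which does; `l` is the place where it
crosses. -/
theorem exists_push_between (hE : StrictMono E) (h : M.IsClosedChain (Set.range E)) (j : Fin s) :
    ∃ (l : Fin s) (i : ℤ), M.push i (E l.castSucc) ≤ E j.castSucc ∧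
      E j.succ ≤ M.push i (E l.succ) := by
  have hj0 : ¬ E j.succ ≤ ⊥ := by
    rw [← h.enum_zero hE, hE.le_iff_le, not_le]
    exact Fin.succ_pos j
  obtain ⟨i, hi, hmin⟩ : ∃ i, E j.succ ≤ M.D i ∧ ∀ z, E j.succ ≤ M.D z → i ≤ z := by
    obtain ⟨N, hN⟩ := M.D_eq_bot
    obtain ⟨N', hN'⟩ := M.D_eq_top
    refine Int.exists_least_of_bdd ⟨N, fun z hz => ?_⟩ ⟨N', by rw [hN' _ le_rfl]; exact le_top⟩
    by_contra hlt
    rw [hN z (by omega)] at hz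
    exact hj0 hz
  have hi' : ¬ E j.succ ≤ M.D (i - 1) := fun hle => by
    have := hmin _ hle
    omega
  obtain ⟨l, hl, hl'⟩ := Fin.exists_castSucc_succ (fun t => E j.succ ≤ M.push i (E t))
    (by rwa [h.enum_zero hE, push_bot]) (by rwa [h.enum_last hE, push_top])
  exact ⟨l, i, hE.le_castSucc_of_not_succ_le (h.push_mem _ _ ⟨_, rfl⟩) hl, hl'⟩

/-- `push i (E t)` increases lexicographically in `(i, t)`, because `push i N ≤ D i ≤ D (i' - 1) ≤
push i' N'` for `i < i'`. So each step is crossed only once. -/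
theorem push_between_unique (hE : StrictMono E) {j l l' : Fin s} {i i' : ℤ}
    (h1 : M.push i (E l.castSucc) ≤ E j.castSucc) (h2 : E j.succ ≤ M.push i (E l.succ))
    (h1' : M.push i' (E l'.castSucc) ≤ E j.castSucc) (h2' : E j.succ ≤ M.push i' (E l'.succ)) :
    l = l' ∧ i = i' := by
  have hj : ¬ E j.succ ≤ E j.castSucc := by
    rw [hE.le_iff_le, not_le]
    exact Fin.castSucc_lt_succ
  have key : ∀ {l l' : Fin s} {i i' : ℤ}, E j.succ ≤ M.push i (E l.succ) →
      M.push i' (E l'.castSucc) ≤ E j.castSucc → i' ≤ i ∧ (i = i' → l' ≤ l) := by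
    intro l l' i i' h2 h1'
    refine ⟨?_, ?_⟩
    · by_contra hlt
      exact hj ((h2.trans push_le_D).trans ((M.D_mono (by omega)).trans (D_le_push.trans h1')))
    · rintro rfl
      by_contra hlt
      refine hj (h2.trans ((push_mono (hE.monotone ?_)).trans h1'))
      exact Fin.succ_le_castSucc_iff.2 (not_le.1 hlt)
  have a := key h2 h1'
  have b := key h2' h1
  have hi : i = i' := le_antisymm b.1 a.1
  exact ⟨le_antisymm (b.2 hi.symm) (a.2 hi), hi⟩

/-- Every step `N < N'` between subspaces gives a strict step under `push i` for some `i`. -/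
theorem exists_push_lt {N N' : Submodule K M.carrier} (h : N < N') :
    ∃ i, M.push i N < M.push i N' := by
  -- Take `i` greatest such that `C i` meets `N' \ N`. If the image of `x` came from some `x' ∈ N`,
  -- then `x - x'` would be a vector of `C (i + 1)` in `N' \ N`.
  obtain ⟨i, ⟨x, hxC, hxN', hxN⟩, hmax⟩ : ∃ i, (∃ x ∈ M.C i, x ∈ N' ∧ x ∉ N) ∧
      ∀ z, (∃ x ∈ M.C z, x ∈ N' ∧ x ∉ N) → z ≤ i := by
    obtain ⟨B, hB⟩ := M.C_eq_top
    obtain ⟨B', hB'⟩ := M.C_eq_bot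
    obtain ⟨x, hx, hx'⟩ := SetLike.exists_of_lt h
    refine Int.exists_greatest_of_bdd ⟨B', ?_⟩ ⟨B, x, ?_, hx, hx'⟩
    · rintro z ⟨x, hxC, hx, hx'⟩
      by_contra hlt
      rw [hB' z (by omega), Submodule.mem_bot] at hxC
      exact hx' (hxC ▸ zero_mem _)
    · rw [hB _ le_rfl]
      trivial
  obtain ⟨y, hy⟩ := exists_rel_right hxC
  refine ⟨i, SetLike.lt_iff_le_and_exists.2 ⟨push_mono h.le, y, mem_push.2 ⟨x, hxN', hy⟩,
    fun hy' => ?_⟩⟩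
  obtain ⟨x', hx', hsub⟩ := hy.exists_sub_mem hy'
  have := hmax (i + 1) ⟨x - x', hsub, sub_mem hxN' (h.le hx'), fun hmem => hxN ?_⟩
  · omega
  · simpa using add_mem hmem hx'

/-- On each step of a closed chain exactly one `push i` is nontrivial, and it maps the step onto
another step; this gives a permutation of the steps. -/
theorem IsClosedChain.exists_perm (hE : StrictMono E) (h : M.IsClosedChain (Set.range E)) :
    ∃ (ι : Fin s → ℤ) (π : Equiv.Perm (Fin s)), ∀ l,
      M.push (ι l) (E l.castSucc) = E (π l).castSucc ∧
      M.push (ι l) (E l.succ) = E (π l).succ ∧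
      ∀ i ≠ ι l, M.push i (E l.castSucc) = M.push i (E l.succ) := by
  -- `P j` is the step and `I j` the index from which step `j` is reached; `π` will be the inverse
  -- of `P`.
  choose P I hP1 hP2 using exists_push_between hE h
  have step : ∀ (l : Fin s) (i : ℤ), M.push i (E l.castSucc) < M.push i (E l.succ) →
      ∃ j, P j = l ∧ I j = i ∧ M.push i (E l.castSucc) = E j.castSucc := by
    intro l i hlt
    obtain ⟨m, hm⟩ := h.push_mem i _ ⟨l.castSucc, rfl⟩
    obtain ⟨m', hm'⟩ := h.push_mem i _ ⟨l.succ, rfl⟩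
    rw [← hm, ← hm', hE.lt_iff_lt] at hlt
    obtain ⟨j, rfl⟩ := Fin.exists_castSucc_eq.2 (ne_of_lt (hlt.trans_le (Fin.le_last m')))
    have := push_between_unique hE (hP1 j) (hP2 j) (l' := l) (i' := i) hm.ge
      (hm' ▸ hE.monotone (Fin.castSucc_lt_iff_succ_le.1 hlt))
    exact ⟨j, this.1, this.2, hm.symm⟩
  have step' : ∀ (l : Fin s) (i : ℤ), M.push i (E l.castSucc) < M.push i (E l.succ) →
      ∃ j, P j = l ∧ M.push i (E l.succ) = E j.succ := by
    intro l i hlt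
    obtain ⟨m, hm⟩ := h.push_mem i _ ⟨l.castSucc, rfl⟩
    obtain ⟨m', hm'⟩ := h.push_mem i _ ⟨l.succ, rfl⟩
    rw [← hm, ← hm', hE.lt_iff_lt] at hlt
    obtain ⟨j, rfl⟩ := Fin.exists_succ_eq.2 (ne_of_gt ((Fin.zero_le m).trans_lt hlt))
    have := push_between_unique hE (hP1 j) (hP2 j) (l' := l) (i' := i)
      (hm ▸ hE.monotone (Fin.le_castSucc_iff.2 hlt)) hm'.le
    exact ⟨j, this.1, hm'.symm⟩
  have hstep : ∀ l : Fin s, ∃ i, M.push i (E l.castSucc) < M.push i (E l.succ) := fun l =>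
    exists_push_lt (hE Fin.castSucc_lt_succ)
  have hsurj : Function.Surjective P := fun l => by
    obtain ⟨i, hi⟩ := hstep l
    obtain ⟨j, hj, -⟩ := step l i hi
    exact ⟨j, hj⟩
  -- A strict image of step `l` might span several steps. `step` finds its lowest step and `step'`
  -- its highest; `P` sends both to `l`, so bijectivity of `P` makes them equal.
  let e := Equiv.ofBijective P (Finite.injective_iff_bijective.1
    (Finite.injective_iff_surjective.2 hsurj))
  have he : ∀ {j l}, P j = l → e.symm l = j := fun {j l} hj => (e.symm_apply_eq).2 hj.symm
  refine ⟨fun l => I (e.symm l), e.symm, fun l => ?_⟩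
  obtain ⟨i, hi⟩ := hstep l
  have huniq : ∀ i, M.push i (E l.castSucc) < M.push i (E l.succ) → I (e.symm l) = i := by
    intro i hi
    obtain ⟨j, hj, hj', -⟩ := step l i hi
    rw [he hj, hj']
  beta_reduce
  rw [huniq i hi]
  refine ⟨?_, ?_, fun i' hi' => ?_⟩
  · obtain ⟨j, hj, -, h'⟩ := step l i hi
    rw [he hj, h']
  · obtain ⟨j, hj, h'⟩ := step' l i hi
    rw [he hj, h']
  · by_contra hne
    exact hi' ((huniq i' (lt_of_le_of_ne
      (push_mono (hE.monotone Fin.castSucc_lt_succ.le)) hne)).symm.trans (huniq i hi))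

end Enum

end FZip

/-! ### Canonical and maximal closed chains; existence of a full closed flag. -/

namespace FZip

variable {p : ℕ} [Fact p.Prime] {k : Type u} [Field k] [CharP k p]
variable {M : FZip.{u, v} p k}

/-- Choose preimages of a basis of `B` and extend with `p`-th roots of coefficients. This inverts
the relation by an actual operator, to which the fixed-vector results apply. -/
theorem exists_semilinear_rel [PerfectRing k p] (i : ℤ) (A B : Submodule k M.carrier)
    (h : ∀ y ∈ B, ∃ x ∈ A, M.Rel i x y) :
    ∃ g : B →ₛₗ[invFrob p k] A, ∀ y : B, M.Rel i (g y) y := by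
  let b := Module.finBasis k B
  have h' : ∀ j, ∃ x : A, M.Rel i x (b j) := fun j => by
    obtain ⟨x, hx, hxy⟩ := h _ (b j).2
    exact ⟨⟨x, hx⟩, hxy⟩
  choose x hx using h'
  refine ⟨{ toFun := fun y => ∑ j, invFrob p k (b.repr y j) • x j
            map_add' := fun y y' => ?_
            map_smul' := fun c y => ?_ }, fun y => ?_⟩
  · rw [← Finset.sum_add_distrib]
    exact Finset.sum_congr rfl fun j _ => by
      rw [map_add, Finsupp.add_apply, map_add, add_smul]
  · rw [Finset.smul_sum]
    exact Finset.sum_congr rfl fun j _ => by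
      rw [map_smul, Finsupp.smul_apply, smul_eq_mul, map_mul, mul_smul]
  · have hy : (y : M.carrier) = ∑ j, b.repr y j • (b j : M.carrier) := by
      conv_lhs => rw [← b.sum_repr y]
      rw [Submodule.coe_sum]
      rfl
    rw [hy]
    change M.Rel i ((∑ j, invFrob p k (b.repr y j) • x j : A) : M.carrier) _
    rw [Submodule.coe_sum]
    refine Rel.sum _ fun j _ => ?_
    have := (hx j).smul (invFrob p k (b.repr y j))
    rwa [invFrob_pow'] at this

section Canonical

variable (M)

/-- The subspaces obtained from `0` by applying the maps `push i` repeatedly. -/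
inductive Canonical [PerfectRing k p] : Submodule k M.carrier → Prop
  | bot : Canonical ⊥
  | push (i : ℤ) (N : Submodule k M.carrier) : Canonical N → Canonical (M.push i N)

variable [PerfectRing k p]

/-- Images under different `push i` are separated by the filtration `D`; images under the same one
are compared by induction. -/
theorem isClosedChain_canonical : M.IsClosedChain {N | M.Canonical N} := by
  refine ⟨?_, Canonical.bot, fun i N hN => Canonical.push i N hN⟩
  have key : ∀ N, M.Canonical N → ∀ N', M.Canonical N' → N ≤ N' ∨ N' ≤ N := by
    intro N hN
    induction hN with
    | bot => exact fun N' _ => Or.inl bot_le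
    | push i N hN ih =>
      intro N' hN'
      cases hN' with
      | bot => exact Or.inr bot_le
      | push i' N' hN' =>
        rcases lt_trichotomy i i' with h | rfl | h
        · exact Or.inl (push_le_D.trans ((M.D_mono (by omega)).trans D_le_push))
        · exact (ih N' hN').imp push_mono push_mono
        · exact Or.inr (push_le_D.trans ((M.D_mono (by omega)).trans D_le_push))
  exact fun N hN N' hN' _ => key N hN N' hN'

theorem exists_maximal_isClosedChain : ∃ 𝓔, M.IsClosedChain 𝓔 ∧
    ∀ 𝓔', M.IsClosedChain 𝓔' → 𝓔 ⊆ 𝓔' → 𝓔' ⊆ 𝓔 := by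
  obtain ⟨𝓔, -, h⟩ := zorn_subset_nonempty {𝓔 | M.IsClosedChain 𝓔} (fun c hc hchain hne => by
    refine ⟨⋃₀ c, ⟨?_, ?_, ?_⟩, fun s hs => Set.subset_sUnion_of_mem hs⟩
    · rintro N ⟨s, hs, hN⟩ N' ⟨s', hs', hN'⟩ hne
      rcases hchain.total hs hs' with hle | hle
      · exact (hc hs').chain (hle hN) hN' hne
      · exact (hc hs).chain hN (hle hN') hne
    · obtain ⟨s, hs⟩ := hne
      exact ⟨s, hs, (hc hs).bot_mem⟩
    · rintro i N ⟨s, hs, hN⟩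
      exact ⟨s, hs, (hc hs).push_mem i N hN⟩) _ M.isClosedChain_canonical
  exact ⟨𝓔, h.prop, fun 𝓔' h' hle => h.le_of_ge h' hle⟩

end Canonical

variable [IsAlgClosed k] {s : ℕ} {E : Fin (s + 1) → Submodule k M.carrier}

/-- Given the permutation `π` of the steps of a closed chain, there are families of vectors in the
steps that are permuted by the relations of the `F`-zip, with a prescribed nonzero component. -/
theorem exists_rel_family (hE : StrictMono E) {ι : Fin s → ℤ} {π : Equiv.Perm (Fin s)}
    (H1 : ∀ l, M.push (ι l) (E l.castSucc) = E (π l).castSucc)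
    (H2 : ∀ l, M.push (ι l) (E l.succ) = E (π l).succ) (l₀ : Fin s) :
    ∃ z : Fin s → M.carrier, (∀ l, z l ∈ E l.succ) ∧ (∀ l, M.Rel (ι l) (z l) (z (π l))) ∧
      z l₀ ∉ E l₀.castSucc := by
  classical
  let X : Fin s → Submodule k M.carrier := fun l => E l.succ ⊓ M.C (ι l)
  have hX : ∀ l, ∀ y ∈ X (π l), ∃ x ∈ X l, M.Rel (ι l) x y := by
    rintro l y ⟨hy, -⟩
    rw [SetLike.mem_coe, ← H2] at hy
    obtain ⟨x, hx, hxy⟩ := hy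
    exact ⟨x, ⟨hx, hxy.mem_C⟩, hxy⟩
  choose g hg using fun l => exists_semilinear_rel (ι l) (X l) (X (π l)) (hX l)
  -- The fixed points of `G` are families with `z l` related to `z (π l)` for all `l`.
  let G : (∀ l, X l) →ₛₗ[invFrob p k] (∀ l, X l) :=
    { toFun := fun z l => g l (z (π l))
      map_add' := fun z z' => by ext l; simp
      map_smul' := fun c z => by ext l; simp }
  have hG : ∀ z l, M.Rel (ι l) (G z l) (z (π l)) := fun z l => hg l _
  -- Applied with `G^[m] z = 0`: the part on which `G` is nilpotent lies in the lower ends `E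
  -- l.castSucc`, since `push (ι l)` carries lower ends to lower ends.
  have hback : ∀ m z, (∀ l, (G^[m] z l : M.carrier) ∈ E l.castSucc) →
      ∀ l, (z l : M.carrier) ∈ E l.castSucc := by
    intro m
    induction m with
    | zero => exact fun z h => h
    | succ m ih =>
      intro z h l
      have h1 := ih (G z) h (π.symm l)
      have h2 := hG z (π.symm l)
      rw [Equiv.apply_symm_apply] at h2
      have h3 : (z l : M.carrier) ∈ M.push (ι (π.symm l)) (E (π.symm l).castSucc) := ⟨_, h1, h2⟩
      rwa [H1, Equiv.apply_symm_apply] at h3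
  obtain ⟨x, hx, hx'⟩ : ∃ x ∈ X l₀, x ∉ E l₀.castSucc := by
    have hlt : M.push (ι l₀) (E l₀.castSucc) < M.push (ι l₀) (E l₀.succ) := by
      rw [H1, H2]
      exact hE Fin.castSucc_lt_succ
    obtain ⟨y, ⟨x, hx, hxy⟩, hy⟩ := SetLike.exists_of_lt hlt
    exact ⟨x, ⟨hx, hxy.mem_C⟩, fun h => hy ⟨x, h, hxy⟩⟩
  by_contra hcon
  push Not at hcon
  have hfix : ∀ z ∈ Submodule.span k {w | G w = w}, (z l₀ : M.carrier) ∈ E l₀.castSucc := by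
    intro z hz
    induction hz using Submodule.span_induction with
    | mem w hw =>
      refine hcon (fun l => w l) (fun l => (w l).2.1) fun l => ?_
      have := hG w l
      rwa [show G w = w from hw] at this
    | zero => exact zero_mem _
    | add _ _ _ _ h1 h2 => exact add_mem h1 h2
    | smul c _ _ h => exact Submodule.smul_mem _ _ h
  -- If fixed families never left `E l₀.castSucc` at `l₀`, both summands of `y` (in the fixed span
  -- and nilpotent) would have their component at `l₀` there, hence so would `x`.
  let y : ∀ l, X l := Pi.single l₀ ⟨x, hx⟩
  obtain ⟨z, hz, m, hm⟩ := exists_mem_span_fixed p G y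
  have h1 := hback m (y - z) (fun l => by rw [hm]; exact zero_mem _) l₀
  have h2 := add_mem h1 (hfix z hz)
  refine hx' ?_
  simpa [y] using h2

/-- A maximal closed chain is a full flag: successive dimensions differ by one. -/
theorem IsClosedChain.finrank_succ_of_maximal (hE : StrictMono E)
    (h : M.IsClosedChain (Set.range E))
    (hmax : ∀ 𝓔, M.IsClosedChain 𝓔 → Set.range E ⊆ 𝓔 → 𝓔 ⊆ Set.range E) (l : Fin s) :
    Module.finrank k (E l.succ) = Module.finrank k (E l.castSucc) + 1 := by
  obtain ⟨ι, π, H⟩ := h.exists_perm hE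
  obtain ⟨z, hzE, hz, hzl⟩ := exists_rel_family hE (fun l => (H l).1) (fun l => (H l).2.1) l
  -- All steps are refined at once, so that the enlarged chain stays closed under `push`. If `z j`
  -- already lies in `E j.castSucc`, nothing is added at `j`.
  let N : Fin s → Submodule k M.carrier := fun j => E j.castSucc ⊔ Submodule.span k {z j}
  have hN1 : ∀ j, E j.castSucc ≤ N j := fun j => le_sup_left
  have hN2 : ∀ j, N j ≤ E j.succ := fun j => sup_le (hE.monotone Fin.castSucc_lt_succ.le)
    ((Submodule.span_singleton_le_iff_mem _ _).2 (hzE j))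
  have hpush : ∀ i j, M.push i (N j) ∈ Set.range E ∪ Set.range N := by
    intro i j
    by_cases hi : i = ι j
    · right
      refine ⟨π j, ?_⟩
      subst hi
      apply le_antisymm
      · refine sup_le ?_ ((Submodule.span_singleton_le_iff_mem _ _).2 ?_)
        · rw [← (H j).1]
          exact push_mono (hN1 j)
        · exact ⟨z j, Submodule.mem_sup_right (Submodule.mem_span_singleton_self _), hz j⟩
      · rintro y ⟨x, hx, hxy⟩
        obtain ⟨e, he, t, ht, rfl⟩ := Submodule.mem_sup.1 hx
        obtain ⟨c, rfl⟩ := Submodule.mem_span_singleton.1 ht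
        have h1 := hxy.sub ((hz j).smul c)
        rw [add_sub_cancel_right] at h1
        have h2 : y - c ^ p • z (π j) ∈ E (π j).castSucc := by
          rw [← (H j).1]
          exact ⟨e, he, h1⟩
        rw [← sub_add_cancel y (c ^ p • z (π j))]
        exact add_mem (hN1 _ h2) (Submodule.smul_mem _ _
          (Submodule.mem_sup_right (Submodule.mem_span_singleton_self _)))
    · left
      -- For `i ≠ ι j`, `push i` agrees at both ends of the step, so it takes the same value on `N
      -- j` in between.
      obtain ⟨m, hm⟩ := h.push_mem i _ ⟨j.castSucc, rfl⟩
      refine ⟨m, hm.trans (le_antisymm (push_mono (hN1 j)) ?_)⟩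
      rw [(H j).2.2 i hi]
      exact push_mono (hN2 j)
  have hcomp : ∀ j t, E t ≤ N j ∨ N j ≤ E t := by
    intro j t
    rcases le_or_gt t j.castSucc with ht | ht
    · exact Or.inl ((hE.monotone ht).trans (hN1 j))
    · exact Or.inr ((hN2 j).trans (hE.monotone (Fin.castSucc_lt_iff_succ_le.1 ht)))
  have hcomp' : ∀ j j', N j ≤ N j' ∨ N j' ≤ N j := by
    intro j j'
    rcases lt_trichotomy j j' with hj | rfl | hj
    · exact Or.inl ((hN2 j).trans ((hE.monotone (Fin.succ_le_castSucc_iff.2 hj)).trans (hN1 j')))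
    · exact Or.inl le_rfl
    · exact Or.inr ((hN2 j').trans ((hE.monotone (Fin.succ_le_castSucc_iff.2 hj)).trans (hN1 j)))
  have hclosed : M.IsClosedChain (Set.range E ∪ Set.range N) := by
    refine ⟨?_, Or.inl h.bot_mem, ?_⟩
    · rintro _ (⟨t, rfl⟩ | ⟨t, rfl⟩) _ (⟨t', rfl⟩ | ⟨t', rfl⟩) -
      · exact (le_total t t').imp (fun h => hE.monotone h) fun h => hE.monotone h
      · exact hcomp t' t
      · exact (hcomp t t').symm
      · exact hcomp' t t'
    · rintro i _ (ht | ⟨j, rfl⟩)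
      · exact Or.inl (h.push_mem i _ ht)
      · exact hpush i j
  obtain ⟨t, ht⟩ := hmax _ hclosed Set.subset_union_left (Or.inr ⟨l, rfl⟩)
  have hzN : z l ∈ N l := Submodule.mem_sup_right (Submodule.mem_span_singleton_self _)
  -- By maximality `N l` is a member of the chain. As `z l ∉ E l.castSucc`, it must be the next one.
  have heq : E l.succ = N l := by
    refine le_antisymm ?_ (hN2 l)
    rw [← ht, hE.le_iff_le]
    by_contra hlt
    refine hzl ?_
    rw [← ht] at hzN
    exact hE.monotone (Fin.le_castSucc_iff.2 (not_le.1 hlt)) hzN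
  rw [heq, Submodule.finrank_sup_span_singleton hzl]

/-- Every `F`-zip over an algebraically closed field has a full flag that is closed under all
`push i`. -/
theorem exists_full_flag (M : FZip.{u, v} p k) :
    ∃ (s : ℕ) (E : Fin (s + 1) → Submodule k M.carrier), StrictMono E ∧
      M.IsClosedChain (Set.range E) ∧ ∀ t, Module.finrank k (E t) = t := by
  obtain ⟨𝓔, h, hmax⟩ := M.exists_maximal_isClosedChain
  obtain ⟨s, E, hE, rfl⟩ := h.exists_enum
  refine ⟨s, E, hE, h, fun t => ?_⟩
  induction t using Fin.induction with
  | zero => rw [h.enum_zero hE, finrank_bot]; rfl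
  | succ l ih => rw [h.finrank_succ_of_maximal hE hmax l, ih]; simp

end FZip

/-! ### Elements of `^J W` as distributions of positions over blocks. -/

namespace ZipType

variable (τ : ℤ →₀ ℕ)

theorem head_add_le_rank (i : ℤ) : head τ i + τ i ≤ rank τ := by
  have := head_add_add_tail τ i
  omega

theorem head_add_le_head {i j : ℤ} (h : i < j) : head τ i + τ i ≤ head τ j := by
  have h1 := head_pred τ (i + 1)
  rw [add_sub_cancel_right] at h1
  rw [h1]
  exact head_mono τ h

theorem x_val (a : Fin (rank τ)) :
    (x τ a : ℕ) = a - tail τ (index τ a) + head τ (index τ a) := rfl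

theorem head_le_x (a : Fin (rank τ)) : head τ (index τ a) ≤ x τ a :=
  ((x_mem_iff τ a _).2 (index_spec τ a)).1

theorem x_lt (a : Fin (rank τ)) : (x τ a : ℕ) < head τ (index τ a) + τ (index τ a) :=
  ((x_mem_iff τ a _).2 (index_spec τ a)).2

theorem x_lt_iff (a : Fin (rank τ)) (i : ℤ) :
    (x τ a : ℕ) < head τ i + τ i ↔ index τ a ≤ i := by
  have h1 := head_le_x τ a
  have h2 := x_lt τ a
  constructor
  · intro h
    by_contra hlt
    have := head_add_le_head τ (not_le.1 hlt)
    omega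
  · intro h
    rcases h.eq_or_lt with rfl | h
    · exact h2
    · have := head_add_le_head τ h
      omega

theorem head_le_x_iff (a : Fin (rank τ)) (i : ℤ) : head τ i ≤ x τ a ↔ i ≤ index τ a := by
  rw [← head_pred, ← not_lt, x_lt_iff]
  omega

variable {τ}

/-- The number of `b < t` with `f b = i`. -/
def countLT {n : ℕ} (f : Fin n → ℤ) (i : ℤ) (t : ℕ) : ℕ :=
  (Finset.univ.filter fun b : Fin n => (b : ℕ) < t ∧ f b = i).card

theorem countLT_mono {n : ℕ} (f : Fin n → ℤ) (i : ℤ) : Monotone (countLT f i) :=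
  fun _ _ h => Finset.card_le_card fun b hb => by
    simp only [Finset.mem_filter] at hb ⊢
    exact ⟨hb.1, by omega, hb.2.2⟩

theorem countLT_zero {n : ℕ} (f : Fin n → ℤ) (i : ℤ) : countLT f i 0 = 0 := by
  simp [countLT]

theorem countLT_succ {n : ℕ} (f : Fin n → ℤ) (i : ℤ) (a : Fin n) :
    countLT f i (a + 1) = countLT f i a + if f a = i then 1 else 0 := by
  have h : (Finset.univ.filter fun b : Fin n => (b : ℕ) < a + 1 ∧ f b = i) =
      (Finset.univ.filter fun b : Fin n => (b : ℕ) < a ∧ f b = i) ∪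
        (Finset.univ.filter fun b : Fin n => b = a ∧ f b = i) := by
    ext b
    simp only [Finset.mem_filter, Finset.mem_union, Finset.mem_univ, true_and, ← or_and_right,
      Fin.ext_iff, Nat.lt_succ_iff_lt_or_eq]
  rw [countLT, h, Finset.card_union_of_disjoint, countLT]
  · congr 1
    split_ifs with ha
    · rw [Finset.card_eq_one]
      refine ⟨a, ?_⟩
      ext b
      simp only [Finset.mem_filter, Finset.mem_univ, true_and, Finset.mem_singleton]
      exact ⟨fun h => h.1, fun h => ⟨h, h ▸ ha⟩⟩
    · rw [Finset.card_eq_zero, Finset.filter_eq_empty_iff]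
      rintro b - ⟨rfl, hb⟩
      exact ha hb
  · rw [Finset.disjoint_filter]
    rintro b - ⟨h1, -⟩ ⟨rfl, -⟩
    omega

/-- The count for the value `f a` increases on passing from `a` to `a + 1`. -/
theorem countLT_lt_iff {n : ℕ} (f : Fin n → ℤ) (a : Fin n) (t : ℕ) :
    countLT f (f a) a < countLT f (f a) t ↔ (a : ℕ) < t := by
  constructor
  · intro h
    by_contra hlt
    exact absurd (countLT_mono f (f a) (not_lt.1 hlt)) (not_le.2 h)
  · intro h
    have h1 := countLT_succ f (f a) a
    rw [if_pos rfl] at h1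
    have h2 := countLT_mono f (f a) (show (a : ℕ) + 1 ≤ t from h)
    omega

/-- A permutation in `^J W` is determined by the blocks to which it maps the positions. -/
theorem JW_apply {u : Equiv.Perm (Fin (rank τ))} (hu : u ∈ JW τ) (a : Fin (rank τ)) :
    (u a : ℕ) = tail τ (index τ (u a)) + countLT (fun b => index τ (u b)) (index τ (u a)) a := by
  have hspec := index_spec τ (u a)
  -- As `u⁻¹` is increasing on the block, its elements below `u a` are exactly the images of earlier
  -- positions with the same block.
  have hcard : countLT (fun b => index τ (u b)) (index τ (u a)) a =
      (Finset.Ico (tail τ (index τ (u a))) (u a : ℕ)).card := by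
    refine Finset.card_bij (fun b _ => (u b : ℕ)) ?_ ?_ ?_
    · intro b hb
      simp only [Finset.mem_filter, Finset.mem_univ, true_and] at hb
      have hb' : u b ∈ blockJ τ (index τ (u a)) := (mem_blockJ_iff τ _ _).2 hb.2
      rw [Finset.mem_Ico]
      refine ⟨hb'.1, ?_⟩
      by_contra hlt
      have h := (hu (index τ (u a))).monotoneOn hspec hb' (not_lt.1 hlt)
      simp only [Equiv.Perm.inv_def, Equiv.symm_apply_apply] at h
      have : (a : ℕ) ≤ b := h
      omega
    · intro b _ b' _ h
      exact u.injective (Fin.ext h)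
    · intro c hc
      rw [Finset.mem_Ico] at hc
      have hclt : c < rank τ := hc.2.trans (u a).2
      have hc' : (⟨c, hclt⟩ : Fin (rank τ)) ∈ blockJ τ (index τ (u a)) :=
        ⟨hc.1, hc.2.trans hspec.2⟩
      refine ⟨u⁻¹ ⟨c, hclt⟩, ?_, by simp⟩
      simp only [Finset.mem_filter, Finset.mem_univ, true_and, Equiv.Perm.inv_def, Equiv.apply_symm_apply]
      refine ⟨?_, (mem_blockJ_iff τ _ _).1 hc'⟩
      have h := hu (index τ (u a)) hc' hspec (show (⟨c, hclt⟩ : Fin (rank τ)) < u a from hc.2)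
      simpa using h
  rw [hcard, Nat.card_Ico]
  have := hspec.1
  omega

theorem JW_ext {u u' : Equiv.Perm (Fin (rank τ))} (hu : u ∈ JW τ) (hu' : u' ∈ JW τ)
    (h : ∀ a, index τ (u a) = index τ (u' a)) : u = u' := by
  ext a
  rw [JW_apply hu, JW_apply hu', h a]
  simp only [h]

/-- `a ↦ x (u a)` is the stable sort of positions by block index. The same formula arises from
dimensions of `push i` on a flag, which identifies the two permutations. -/
theorem x_apply_JW {u : Equiv.Perm (Fin (rank τ))} (hu : u ∈ JW τ) (a : Fin (rank τ)) :
    (x τ (u a) : ℕ) =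
      head τ (index τ (u a)) + countLT (fun b => index τ (u b)) (index τ (u a)) a := by
  have := JW_apply hu a
  rw [x_val]
  omega

/-- Every distribution of the positions over the blocks comes from an element of `^J W`. -/
theorem exists_JW (ι : Fin (rank τ) → ℤ) (hι : ∀ i, countLT ι i (rank τ) = τ i) :
    ∃ u ∈ JW τ, ∀ a, index τ (u a) = ι a := by
  have hlt : ∀ a, countLT ι (ι a) a < τ (ι a) := fun a => by
    rw [← hι, countLT_lt_iff]
    exact a.2
  -- Each block is filled from the left in the order of positions; the counting hypothesis makes
  -- everything fit.
  let f : Fin (rank τ) → Fin (rank τ) := fun a => ⟨tail τ (ι a) + countLT ι (ι a) a, by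
    have := hlt a
    have := head_add_add_tail τ (ι a)
    omega⟩
  have hf : ∀ a, f a ∈ blockJ τ (ι a) := fun a => ⟨Nat.le_add_right _ _, by
    have := hlt a
    simp only [f]
    omega⟩
  have hidx : ∀ a, index τ (f a) = ι a := fun a => (mem_blockJ_iff τ _ _).1 (hf a)
  have hmono : ∀ a b, ι a = ι b → f a < f b → a < b := by
    intro a b hab h
    have h' : tail τ (ι a) + countLT ι (ι a) a < tail τ (ι b) + countLT ι (ι b) b := h
    rw [← hab] at h'
    exact (countLT_lt_iff ι a b).1 (by omega)
  have hinj : Function.Injective f := by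
    intro a b hab
    have hιab : ι a = ι b := by rw [← hidx, hab, hidx]
    have h' : tail τ (ι a) + countLT ι (ι a) a = tail τ (ι b) + countLT ι (ι b) b :=
      congrArg Fin.val hab
    rcases lt_trichotomy a b with h | h | h
    · have := (countLT_lt_iff ι a b).2 h
      rw [← hιab] at h'
      omega
    · exact h
    · have := (countLT_lt_iff ι b a).2 h
      rw [hιab] at h'
      omega
  let u : Equiv.Perm (Fin (rank τ)) :=
    Equiv.ofBijective f (Finite.injective_iff_bijective.1 hinj)
  have hu : ∀ a, u a = f a := fun a => rfl
  refine ⟨u, fun i c hc d hd hcd => ?_, hidx⟩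
  obtain ⟨a, rfl⟩ := u.surjective c
  obtain ⟨b, rfl⟩ := u.surjective d
  rw [mem_blockJ_iff, hu, hidx] at hc hd
  simp only [Equiv.Perm.inv_def, Equiv.symm_apply_apply]
  exact hmono a b (hc.trans hd.symm) hcd

theorem card_blockJ (i : ℤ) : Nat.card (blockJ τ i) = τ i := by
  have h := head_add_add_tail τ i
  have e : blockJ τ i ≃ Finset.Ico (tail τ i) (tail τ i + τ i) :=
    { toFun := fun a => ⟨a.1, Finset.mem_Ico.2 a.2⟩
      invFun := fun c => ⟨⟨c.1, by have := (Finset.mem_Ico.1 c.2).2; omega⟩, Finset.mem_Ico.1 c.2⟩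
      left_inv := fun a => rfl
      right_inv := fun c => rfl }
  rw [Nat.card_congr e, Nat.card_eq_fintype_card, Fintype.card_coe, Nat.card_Ico,
    Nat.add_sub_cancel_left]

theorem countLT_index (u : Equiv.Perm (Fin (rank τ))) (i : ℤ) :
    countLT (fun b => index τ (u b)) i (rank τ) = τ i := by
  have e : {b : Fin (rank τ) // (b : ℕ) < rank τ ∧ index τ (u b) = i} ≃ blockJ τ i :=
    u.subtypeEquiv fun b => by
      rw [mem_blockJ_iff]
      exact ⟨fun h => h.2, fun h => ⟨b.2, h⟩⟩
  rw [← card_blockJ, ← Nat.card_congr e, countLT, Nat.card_eq_fintype_card, Fintype.card_subtype]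

/-- `u' * u⁻¹` preserves all blocks exactly when `u a` and `u' a` always share a block. -/
theorem mk_rightRel_eq_iff (u u' : Equiv.Perm (Fin (rank τ))) :
    (Quotient.mk (QuotientGroup.rightRel (WJ τ)) u) = Quotient.mk _ u' ↔
      ∀ a, index τ (u a) = index τ (u' a) := by
  rw [Quotient.eq, QuotientGroup.rightRel_apply]
  constructor
  · intro h a
    have := (h (index τ (u a)) (u a)).2 (index_spec τ _)
    rw [mem_blockJ_iff, Equiv.Perm.mul_apply, Equiv.Perm.inv_def, Equiv.symm_apply_apply] at this
    exact this.symm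
  · intro h i c
    obtain ⟨a, rfl⟩ := u.surjective c
    rw [Equiv.Perm.mul_apply, Equiv.Perm.inv_def, Equiv.symm_apply_apply, mem_blockJ_iff, mem_blockJ_iff, h]

/-- `^J W` is a set of representatives of `W_J \ S_n`. -/
theorem bijOn_mk_JW : Set.BijOn (fun u => (Quotient.mk (QuotientGroup.rightRel (WJ τ)) u))
    (JW τ) Set.univ := by
  refine ⟨fun _ _ => Set.mem_univ _, fun u hu u' hu' h => ?_, fun q _ => ?_⟩
  · exact JW_ext hu hu' ((mk_rightRel_eq_iff u u').1 h)
  · obtain ⟨v, rfl⟩ := Quotient.exists_rep q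
    obtain ⟨u, hu, h⟩ := exists_JW (fun b => index τ (v b)) (countLT_index v)
    exact ⟨u, hu, (mk_rightRel_eq_iff u v).2 h⟩

end ZipType

/-! ### Standard bases: coordinates, isomorphism, uniqueness of the permutation. -/

namespace FZip

open ZipType

variable {p : ℕ} [Fact p.Prime] {k : Type u} [Field k] [CharP k p]

section Flag

variable {V : Type v} [AddCommGroup V] [Module k V] {n : ℕ}

/-- The span of the first `t` vectors of a basis. -/
def basisFlag (e : Module.Basis (Fin n) k V) (t : ℕ) : Submodule k V :=
  Submodule.span k (e '' {b | (b : ℕ) < t})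

theorem mem_basisFlag (e : Module.Basis (Fin n) k V) {t : ℕ} {y : V} :
    y ∈ basisFlag e t ↔ ∀ b : Fin n, t ≤ b → e.repr y b = 0 := by
  rw [basisFlag, Module.Basis.mem_span_image]
  constructor
  · intro h b hb
    by_contra hne
    have : (b : ℕ) < t := h (Finset.mem_coe.2 (Finsupp.mem_support_iff.2 hne))
    omega
  · intro h b hb
    by_contra hlt
    exact Finsupp.mem_support_iff.1 (Finset.mem_coe.1 hb) (h b (not_lt.1 hlt))

theorem basisFlag_mono (e : Module.Basis (Fin n) k V) : Monotone (basisFlag e) :=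
  fun _ _ h => Submodule.span_mono (Set.image_mono fun _ hb => lt_of_lt_of_le hb h)

theorem basis_mem_basisFlag (e : Module.Basis (Fin n) k V) {t : ℕ} {b : Fin n} :
    e b ∈ basisFlag e t ↔ (b : ℕ) < t := by
  constructor
  · intro h
    by_contra hlt
    have := (mem_basisFlag e).1 h b (not_lt.1 hlt)
    simp at this
  · exact fun h => Submodule.subset_span ⟨b, h, rfl⟩

theorem finrank_basisFlag (e : Module.Basis (Fin n) k V) (t : ℕ) :
    Module.finrank k (basisFlag e t) = min t n := by
  have h : basisFlag e t = Submodule.span k (Set.range fun b : {b : Fin n // (b : ℕ) < t} => e b) := by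
    rw [basisFlag, Set.image_eq_range]
    rfl
  rw [h]
  refine (finrank_span_eq_card (e.linearIndependent.comp _ Subtype.val_injective)).trans ?_
  have e' : {b : Fin n // (b : ℕ) < t} ≃ Fin (min t n) :=
    { toFun := fun b => ⟨b.1, lt_min b.2 b.1.2⟩
      invFun := fun b => ⟨⟨b, b.2.trans_le (min_le_right _ _)⟩, b.2.trans_le (min_le_left _ _)⟩
      left_inv := fun b => rfl
      right_inv := fun b => rfl }
  rw [Fintype.card_congr e', Fintype.card_fin]

end Flag

/-- A basis of an `F`-zip in which it looks like the standard `F`-zip of `u`. -/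
structure IsStdBasis (M : FZip.{u, v} p k) {τ : ℤ →₀ ℕ} (u : Equiv.Perm (Fin (rank τ)))
    (e : Module.Basis (Fin (rank τ)) k M.carrier) : Prop where
  mem_D : ∀ i (b : Fin (rank τ)), (b : ℕ) < head τ i + τ i → e b ∈ M.D i
  rel : ∀ a, M.Rel (index τ (u a)) (e a) (e (x τ (u a)))

namespace IsStdBasis

variable {M : FZip.{u, v} p k} {τ : ℤ →₀ ℕ} {u : Equiv.Perm (Fin (rank τ))}
variable {e : Module.Basis (Fin (rank τ)) k M.carrier}

/-- One inclusion is part of the definition, and the dimensions agree because of the type. -/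
theorem D_eq (h : M.IsStdBasis u e) (hM : M.HasType τ) (i : ℤ) :
    M.D i = basisFlag e (head τ i + τ i) := by
  refine (Submodule.eq_of_le_of_finrank_eq (Submodule.span_le.2 ?_) ?_).symm
  · rintro _ ⟨b, hb, rfl⟩
    exact h.mem_D i b hb
  · change Module.finrank k (basisFlag e _) = _
    rw [finrank_basisFlag, M.finrank_D hM, min_eq_left (head_add_le_rank τ i)]

theorem mem_D_iff (h : M.IsStdBasis u e) (hM : M.HasType τ) {i : ℤ} {y : M.carrier} :
    y ∈ M.D i ↔ ∀ a, i < index τ (u a) → e.repr y (x τ (u a)) = 0 := by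
  rw [h.D_eq hM, mem_basisFlag]
  constructor
  · intro hy a ha
    refine hy _ ?_
    rw [← not_lt, x_lt_iff]
    exact not_le.2 ha
  · intro hy b hb
    obtain ⟨a, rfl⟩ := (u.trans (x τ)).surjective b
    refine hy a ?_
    rw [← not_lt, Equiv.trans_apply, x_lt_iff] at hb
    exact not_le.1 hb

theorem mem_C_of (h : M.IsStdBasis u e) {i : ℤ} {y : M.carrier}
    (hy : ∀ a, index τ (u a) < i → e.repr y a = 0) : y ∈ M.C i := by
  rw [← e.sum_repr y]
  refine Submodule.sum_mem _ fun a _ => ?_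
  by_cases ha : index τ (u a) < i
  · rw [hy a ha, zero_smul]
    exact zero_mem _
  · exact Submodule.smul_mem _ _ (M.C_anti (not_lt.1 ha) (h.rel a).mem_C)

/-- The part of `y` in the block `i`. -/
theorem exists_rel_part (h : M.IsStdBasis u e) (i : ℤ) (y : M.carrier) :
    ∃ y₀ z₀, M.Rel i y₀ z₀ ∧
      (∀ a, e.repr y₀ a = if index τ (u a) = i then e.repr y a else 0) ∧
      ∀ a, e.repr z₀ (x τ (u a)) = if index τ (u a) = i then (e.repr y a) ^ p else 0 := by
  classical
  let s := Finset.univ.filter fun a => index τ (u a) = i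
  refine ⟨∑ a ∈ s, e.repr y a • e a, ∑ a ∈ s, (e.repr y a) ^ p • e (x τ (u a)),
    Rel.sum _ fun a ha => ?_, fun a => ?_, fun a => ?_⟩
  · have := h.rel a
    rw [(Finset.mem_filter.1 ha).2] at this
    exact this.smul _
  · simp only [map_sum, map_smul, Module.Basis.repr_self, Finsupp.coe_finsetSum, Finsupp.coe_smul,
      Finset.sum_apply, Pi.smul_apply, Finsupp.single_apply, smul_eq_mul, mul_ite, mul_one,
      mul_zero, Finset.sum_ite_eq', s, Finset.mem_filter, Finset.mem_univ, true_and]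
  · simp only [map_sum, map_smul, Module.Basis.repr_self, Finsupp.coe_finsetSum, Finsupp.coe_smul,
      Finset.sum_apply, Pi.smul_apply, Finsupp.single_apply, smul_eq_mul, mul_ite, mul_one,
      mul_zero, EmbeddingLike.apply_eq_iff_eq, Finset.sum_ite_eq', s, Finset.mem_filter,
      Finset.mem_univ, true_and]

/-- Let `j` be the least block index with a nonzero coordinate of `y`, and suppose `j < i`. Then `y
∈ C (j + 1)`, so its part `y₀` in block `j` is in `C (j + 1)` too and is related to `0`. Its
standard image `z₀` therefore lies in `D (j - 1)`, although its coordinates in block `j` are `p`-th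
powers of those of `y`. -/
theorem mem_C_iff (h : M.IsStdBasis u e) (hM : M.HasType τ) {i : ℤ} {y : M.carrier} :
    y ∈ M.C i ↔ ∀ a, index τ (u a) < i → e.repr y a = 0 := by
  refine ⟨fun hy => ?_, h.mem_C_of⟩
  by_contra hcon
  push Not at hcon
  obtain ⟨a, ha, hne⟩ := hcon
  obtain ⟨B, hB⟩ := Set.Finite.bddBelow (Set.finite_range fun a => index τ (u a))
  obtain ⟨j, ⟨a, rfl, ha, hne⟩, hmin⟩ := Int.exists_least_of_bdd
    (P := fun j => ∃ a, index τ (u a) = j ∧ index τ (u a) < i ∧ e.repr y a ≠ 0)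
    ⟨B, fun z ⟨a, hz, _⟩ => hz ▸ hB ⟨a, rfl⟩⟩ ⟨_, a, rfl, ha, hne⟩
  obtain ⟨y₀, z₀, hrel, hy₀, hz₀⟩ := h.exists_rel_part (index τ (u a)) y
  have h1 : y - y₀ ∈ M.C (index τ (u a) + 1) := by
    refine h.mem_C_of fun b hb => ?_
    rw [map_sub, Finsupp.sub_apply, hy₀]
    split_ifs with hb'
    · exact sub_self _
    · rw [sub_zero]
      by_contra hne'
      have := hmin _ ⟨b, rfl, by omega, hne'⟩
      omega
  have h2 : y ∈ M.C (index τ (u a) + 1) := M.C_anti (by omega) hy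
  have h3 : M.Rel (index τ (u a)) y₀ 0 := by
    rw [rel_zero_right, ← sub_sub_cancel y y₀]
    exact sub_mem h2 h1
  have h4 := hrel.right_unique h3
  rw [sub_zero, h.mem_D_iff hM] at h4
  have h5 := h4 a (by omega)
  rw [hz₀, if_pos rfl] at h5
  exact hne (eq_zero_of_pow_eq_zero h5)

/-- The relations `Rel i` in coordinates. -/
theorem rel_iff (h : M.IsStdBasis u e) (hM : M.HasType τ) {i : ℤ} {y z : M.carrier} :
    M.Rel i y z ↔ ∀ a, (index τ (u a) < i → e.repr y a = 0) ∧
      (i < index τ (u a) → e.repr z (x τ (u a)) = 0) ∧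
      (index τ (u a) = i → e.repr z (x τ (u a)) = (e.repr y a) ^ p) := by
  obtain ⟨y₀, z₀, hrel, hy₀, hz₀⟩ := h.exists_rel_part i y
  have hC : y ∈ M.C i → y - y₀ ∈ M.C (i + 1) := by
    intro hy
    refine h.mem_C_of fun b hb => ?_
    rw [map_sub, Finsupp.sub_apply, hy₀]
    split_ifs with hb'
    · exact sub_self _
    · rw [sub_zero]
      exact (h.mem_C_iff hM).1 hy b (by omega)
  have hrel' : y ∈ M.C i → M.Rel i y z₀ := by
    intro hy
    have := (rel_zero_right.2 (hC hy)).add hrel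
    rwa [sub_add_cancel, zero_add] at this
  constructor
  · intro hyz a
    refine ⟨(h.mem_C_iff hM).1 hyz.mem_C a, (h.mem_D_iff hM).1 hyz.mem_D a, fun ha => ?_⟩
    have h1 := (h.mem_D_iff hM).1 (hyz.right_unique (hrel' hyz.mem_C)) a (by omega)
    rw [map_sub, Finsupp.sub_apply, hz₀, if_pos ha] at h1
    exact sub_eq_zero.1 h1
  · intro H
    have hy : y ∈ M.C i := h.mem_C_of fun a => (H a).1
    have h1 : z - z₀ ∈ M.D (i - 1) := by
      rw [h.mem_D_iff hM]
      intro a ha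
      rw [map_sub, Finsupp.sub_apply, hz₀]
      split_ifs with ha'
      · rw [(H a).2.2 ha', sub_self]
      · rw [(H a).2.1 (by omega), sub_zero]
    have := (rel_zero_left.2 h1).add (hrel' hy)
    rwa [sub_add_cancel, zero_add] at this

theorem map_iso {N : FZip.{u, w} p k} {e : Module.Basis (Fin (rank τ)) k N.carrier}
    (h : N.IsStdBasis u e) (f : M.Iso N) : M.IsStdBasis u (e.map f.toEquiv.symm) := by
  refine ⟨fun i b hb => ?_, fun a => ?_⟩
  · rw [Module.Basis.map_apply, ← f.mem_D, LinearEquiv.apply_symm_apply]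
    exact h.mem_D i b hb
  · rw [← f.rel_iff]
    simpa using h.rel a

/-- Two `F`-zips of the same type with standard bases for the same permutation are isomorphic. -/
theorem nonempty_iso [PerfectRing k p] {N : FZip.{u, w} p k}
    {e' : Module.Basis (Fin (rank τ)) k N.carrier} (h : M.IsStdBasis u e) (hM : M.HasType τ)
    (h' : N.IsStdBasis u e') (hN : N.HasType τ) : Nonempty (M.Iso N) := by
  have hrepr : ∀ y, e'.repr (e.equiv e' (Equiv.refl _) y) = e.repr y := fun y => by
    ext a
    simp [Module.Basis.equiv]
  refine ⟨Iso.ofRel (e.equiv e' (Equiv.refl _)) fun i y z => ?_⟩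
  rw [h.rel_iff hM, h'.rel_iff hN, hrepr, hrepr]

section Uniqueness

variable [PerfectRing k p]

/-- Modulo `D (i - 1)`, `push i` keeps only the vectors of block `i`. Since `u ∈ ^J W`, it lists
them in order, so initial spans go to initial spans. -/
theorem push_basisFlag (h : M.IsStdBasis u e) (hM : M.HasType τ) (hu : u ∈ JW τ) (i : ℤ) (t : ℕ) :
    M.push i (basisFlag e t) =
      basisFlag e (head τ i + countLT (fun b => index τ (u b)) i t) := by
  classical
  have hle : countLT (fun b => index τ (u b)) i t ≤ τ i := by
    rw [← countLT_index u i]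
    exact Finset.card_le_card fun b hb => by
      simp only [Finset.mem_filter] at hb ⊢
      exact ⟨hb.1, b.2, hb.2.2⟩
  have key : ∀ a, head τ i + countLT (fun b => index τ (u b)) i t ≤ x τ (u a) ↔
      i < index τ (u a) ∨ index τ (u a) = i ∧ t ≤ a := by
    intro a
    rcases lt_trichotomy (index τ (u a)) i with ha | ha | ha
    · have h1 := (head_le_x_iff τ (u a) i).not.2 (by omega)
      constructor
      · omega
      · rintro (h | h) <;> omega
    · have h1 := x_apply_JW hu a
      have h2 := countLT_lt_iff (fun b => index τ (u b)) a t
      simp only [ha] at h1 h2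
      omega
    · have h1 := (x_lt_iff τ (u a) i).not.2 (by omega)
      constructor
      · exact fun _ => Or.inl ha
      · omega
  ext y
  rw [mem_basisFlag]
  constructor
  · rintro ⟨z, hz, hzy⟩ b hb
    obtain ⟨a, rfl⟩ := (u.trans (x τ)).surjective b
    have H := (h.rel_iff hM).1 hzy a
    rcases (key a).1 hb with ha | ⟨ha, ha'⟩
    · exact H.2.1 ha
    · rw [Equiv.trans_apply, H.2.2 ha, (mem_basisFlag e).1 hz a ha',
        zero_pow (Fact.out : p.Prime).ne_zero]
  · intro hy
    -- The preimage has `p`-th roots of the coordinates of `y` in block `i`, and zeros elsewhere.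
    let c : Fin (rank τ) → k := fun a =>
      if index τ (u a) = i then invFrob p k (e.repr y (x τ (u a))) else 0
    have hc : ∀ a, e.repr (e.equivFun.symm c) a = c a := fun a => by
      rw [← Module.Basis.equivFun_apply, LinearEquiv.apply_symm_apply]
    refine ⟨e.equivFun.symm c, (mem_basisFlag e).2 fun a ha => ?_, (h.rel_iff hM).2 fun a => ?_⟩
    · rw [hc]
      simp only [c]
      split_ifs with ha'
      · rw [hy _ ((key a).2 (Or.inr ⟨ha', ha⟩)), map_zero]
      · rfl
    · rw [hc]
      refine ⟨fun ha => if_neg (by omega), fun ha => hy _ ((key a).2 (Or.inl ha)), fun ha => ?_⟩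
      simp only [c]
      rw [if_pos ha, invFrob_pow']

theorem canonical_eq_basisFlag (h : M.IsStdBasis u e) (hM : M.HasType τ) (hu : u ∈ JW τ)
    {N : Submodule k M.carrier} (hN : M.Canonical N) : ∃ t, N = basisFlag e t := by
  induction hN with
  | bot => exact ⟨0, by simp [basisFlag]⟩
  | push i N _ ih =>
    obtain ⟨t, rfl⟩ := ih
    exact ⟨_, h.push_basisFlag hM hu i t⟩

/-- The vector `e (x (u a))` separates the two images. -/
theorem push_basisFlag_ne (h : M.IsStdBasis u e) (hM : M.HasType τ) (hu : u ∈ JW τ)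
    (a : Fin (rank τ)) {N N' : Submodule k M.carrier} (hN : N ≤ basisFlag e a)
    (hN' : basisFlag e (a + 1) ≤ N') :
    M.push (index τ (u a)) N ≠ M.push (index τ (u a)) N' := by
  intro heq
  have h1 : M.push (index τ (u a)) (basisFlag e (a + 1)) ≤
      M.push (index τ (u a)) (basisFlag e a) :=
    (push_mono hN').trans (heq.ge.trans (push_mono hN))
  rw [h.push_basisFlag hM hu, h.push_basisFlag hM hu] at h1
  have h2 := countLT_succ (fun b => index τ (u b)) (index τ (u a)) a
  rw [if_pos rfl] at h2
  have h3 := x_apply_JW hu a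
  have h4 := h1 ((basis_mem_basisFlag e (b := x τ (u a))).2 (by omega))
  rw [basis_mem_basisFlag] at h4
  omega

/-- An `F`-zip has standard bases for at most one `u ∈ ^J W`. -/
theorem perm_unique (h : M.IsStdBasis u e) (hM : M.HasType τ) (hu : u ∈ JW τ)
    {u' : Equiv.Perm (Fin (rank τ))} {e' : Module.Basis (Fin (rank τ)) k M.carrier}
    (h' : M.IsStdBasis u' e') (hu' : u' ∈ JW τ) : u = u' := by
  refine JW_ext hu hu' fun a => ?_
  obtain ⟨s, E, hE, hrange⟩ := M.isClosedChain_canonical.exists_enum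
  have hclosed : M.IsClosedChain (Set.range E) := hrange ▸ M.isClosedChain_canonical
  have hcan : ∀ t, M.Canonical (E t) := fun t => by
    have : E t ∈ {N | M.Canonical N} := hrange ▸ ⟨t, rfl⟩
    exact this
  obtain ⟨ι, π, H⟩ := hclosed.exists_perm hE
  -- `l` is the canonical step with `dim E l.castSucc ≤ a < dim E l.succ`; like its label `ι l`, it
  -- does not depend on a basis.
  obtain ⟨l, hl, hl'⟩ := Fin.exists_castSucc_succ (fun t => (a : ℕ) < Module.finrank k (E t))
    (by rw [hclosed.enum_zero hE, finrank_bot]; exact Nat.not_lt_zero _)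
    (by rw [hclosed.enum_last hE, finrank_top, M.finrank_carrier hM]; exact a.2)
  have key : ∀ {u : Equiv.Perm (Fin (rank τ))} {e : Module.Basis (Fin (rank τ)) k M.carrier},
      M.IsStdBasis u e → u ∈ JW τ → index τ (u a) = ι l := by
    intro u e h hu
    obtain ⟨t, ht⟩ := h.canonical_eq_basisFlag hM hu (hcan l.castSucc)
    obtain ⟨t', ht'⟩ := h.canonical_eq_basisFlag hM hu (hcan l.succ)
    rw [ht, finrank_basisFlag] at hl
    rw [ht', finrank_basisFlag] at hl'
    have ha := a.2
    by_contra hne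
    -- `push (index τ (u a))` is strict on step `l`, and only the label `ι l` has that property.
    refine h.push_basisFlag_ne hM hu a ?_ ?_ ((H l).2.2 _ hne)
    · rw [ht]
      exact basisFlag_mono e (by omega)
    · rw [ht']
      exact basisFlag_mono e (by omega)
  rw [key h hu, key h' hu']

end Uniqueness

end IsStdBasis

end FZip

/-! ### Existence of standard bases over an algebraically closed field. -/

namespace FZip

open ZipType

section Existence

variable {p : ℕ} [Fact p.Prime] {k : Type u} [Field k] [CharP k p] [IsAlgClosed k]

/-- A family of representatives of the cycles of a permutation. -/
theorem exists_cycle_rep {α : Type*} (π : Equiv.Perm α) :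
    ∃ r : α → α, (∀ a, r (π a) = r a) ∧ ∀ a, π.SameCycle a (r a) := by
  let S := Equiv.Perm.SameCycle.setoid π
  refine ⟨fun a => (Quotient.mk S a).out, fun a => ?_, fun a => ?_⟩
  · exact congrArg Quotient.out (Quotient.sound (s := S)
      ((Equiv.Perm.sameCycle_apply_left).2 (Equiv.Perm.SameCycle.refl π a)))
  · exact (Quotient.mk_out (s := S) a).symm

/-- Along a full closed flag, vectors can be chosen that are permuted by the relations. -/
theorem exists_rel_vectors {M : FZip.{u, v} p k} {s : ℕ} {E : Fin (s + 1) → Submodule k M.carrier}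
    (hE : StrictMono E) {ι : Fin s → ℤ} {π : Equiv.Perm (Fin s)}
    (H1 : ∀ l, M.push (ι l) (E l.castSucc) = E (π l).castSucc)
    (H2 : ∀ l, M.push (ι l) (E l.succ) = E (π l).succ) :
    ∃ e : Fin s → M.carrier, (∀ l, e l ∈ E l.succ) ∧ (∀ l, e l ∉ E l.castSucc) ∧
      ∀ l, M.Rel (ι l) (e l) (e (π l)) := by
  choose z hzE hz hzl using exists_rel_family hE H1 H2
  obtain ⟨r, hr, hr'⟩ := exists_cycle_rep π
  -- Each cycle uses the family that is nonzero at its representative. Nonvanishing travels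
  -- backwards along the cycle: a component in the lower end of its step pushes the next component
  -- into a lower end.
  refine ⟨fun l => z (r l) l, fun l => hzE _ l, fun l => ?_, fun l => ?_⟩
  · have key : ∀ m l', z (r l) ((π ^ m) l') ∉ E ((π ^ m) l').castSucc →
        z (r l) l' ∉ E l'.castSucc := by
      intro m
      induction m with
      | zero => exact fun l' h => h
      | succ m ih =>
        intro l' h
        rw [pow_succ, Equiv.Perm.mul_apply] at h
        intro hmem
        refine ih (π l') h ?_
        rw [← H1]
        exact ⟨_, hmem, hz _ l'⟩
    obtain ⟨m, -, hm⟩ := (hr' l).exists_pow_eq'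
    refine key m l ?_
    rw [hm]
    exact hzl (r l)
  · simp only [hr]
    exact hz (r l) l

theorem top_le_span_of_flag {K : Type u} [Field K] {V : Type v} [AddCommGroup V] [Module K V]
    [Module.Finite K V] {s : ℕ} {E : Fin (s + 1) → Submodule K V} (hE : Monotone E)
    (h0 : E 0 = ⊥) (hlast : E (Fin.last s) = ⊤) (hdim : ∀ t, Module.finrank K (E t) = t)
    {e : Fin s → V} (he : ∀ l, e l ∈ E l.succ) (he' : ∀ l, e l ∉ E l.castSucc) :
    ⊤ ≤ Submodule.span K (Set.range e) := by
  rw [← hlast]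
  suffices h : ∀ t, E t ≤ Submodule.span K (Set.range e) from h _
  intro t
  induction t using Fin.induction with
  | zero => rw [h0]; exact bot_le
  | succ l ih =>
    have h1 : E l.castSucc ⊔ Submodule.span K {e l} = E l.succ := by
      refine Submodule.eq_of_le_of_finrank_eq (sup_le (hE Fin.castSucc_lt_succ.le)
        ((Submodule.span_singleton_le_iff_mem _ _).2 (he l))) ?_
      rw [Submodule.finrank_sup_span_singleton (he' l), hdim, hdim]
      simp
    rw [← h1]
    exact sup_le ih ((Submodule.span_singleton_le_iff_mem _ _).2
      (Submodule.subset_span ⟨l, rfl⟩))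

/-- Every `F`-zip over an algebraically closed field has a standard basis. -/
theorem exists_isStdBasis (M : FZip.{u, v} p k) {τ : ℤ →₀ ℕ} (hM : M.HasType τ) :
    ∃ u ∈ JW τ, ∃ e : Module.Basis (Fin (rank τ)) k M.carrier, M.IsStdBasis u e := by
  obtain ⟨s, E, hE, hclosed, hdim⟩ := M.exists_full_flag
  have h0 := hclosed.enum_zero hE
  have hlast := hclosed.enum_last hE
  have hs : s = rank τ := by
    have := hdim (Fin.last s)
    rw [hlast, finrank_top, M.finrank_carrier hM] at this
    simpa using this.symm
  subst hs
  obtain ⟨ι, π, H⟩ := hclosed.exists_perm hE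
  -- The dimension starts at `dim D (i - 1)` and grows by one exactly at the steps labelled `i`. At
  -- the top it is `dim D i`, so the label `i` occurs `τ i` times.
  have hcount : ∀ i (t : Fin (rank τ + 1)), Module.finrank k (M.push i (E t)) =
      head τ i + countLT ι i t := by
    intro i t
    induction t using Fin.induction with
    | zero =>
      rw [h0, push_bot, M.finrank_D hM, head_pred, Fin.val_zero, countLT_zero, add_zero]
    | succ l ih =>
      rw [Fin.val_succ, countLT_succ]
      rw [Fin.val_castSucc] at ih
      split_ifs with hi
      · subst hi
        rw [(H l).1, hdim, Fin.val_castSucc] at ih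
        rw [(H l).2.1, hdim, Fin.val_succ, ih, add_assoc]
      · rw [← (H l).2.2 i (Ne.symm hi), ih, add_zero]
  obtain ⟨u, hu, hidx⟩ := exists_JW ι fun i => by
    have h := hcount i (Fin.last _)
    rw [hlast, push_top, M.finrank_D hM, Fin.val_last] at h
    omega
  -- Both sides are the dimension of `push (ι a) (E a.castSucc)`.
  have hπ : ∀ a, x τ (u a) = π a := by
    intro a
    have h := hcount (ι a) a.castSucc
    rw [(H a).1, hdim, Fin.val_castSucc, Fin.val_castSucc] at h
    ext
    rw [x_apply_JW hu, h]
    simp only [hidx]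
  obtain ⟨e, he, he', hrel⟩ := exists_rel_vectors hE (fun l => (H l).1) fun l => (H l).2.1
  let b := basisOfTopLeSpanOfCardEqFinrank e
    (top_le_span_of_flag hE.monotone h0 hlast hdim he he')
    (by rw [Fintype.card_fin, M.finrank_carrier hM])
  have hb : ∀ a, b a = e a := fun a => by simp [b]
  refine ⟨u, hu, b, fun i a ha => ?_, fun a => ?_⟩
  · obtain ⟨t, ht⟩ := hclosed.D_mem i
    have h1 := hdim t
    rw [ht, M.finrank_D hM] at h1
    rw [hb, ← ht]
    exact hE.monotone (Fin.le_iff_val_le_val.2 (by rw [Fin.val_succ]; omega)) (he a)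
  · rw [hb, hb, hπ, hidx]
    exact hrel a

end Existence

/-! ### The standard zips have their type and a standard basis. -/

section Standard

variable {p : ℕ} [Fact p.Prime] {K : Type u} [Field K] [CharP K p]

theorem HasType.baseChange {M : FZip.{u, v} p K} {τ : ℤ →₀ ℕ} (h : M.HasType τ)
    (L : Type w) [Field L] [CharP L p] [Algebra K L] : (M.baseChange L).HasType τ := fun i =>
  (LinearEquiv.finrank_eq (Subquot.baseChange L (M.C_succ_le i)).symm).trans
    ((Module.finrank_baseChange (R := L) (S := K)).trans (h i))

/-- The pure tensor `1 ⊗ [y]` is followed through the isomorphisms composing the new `φ i`. Such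
tensors suffice, since a standard basis only asks about basis vectors. -/
theorem Rel.baseChange {M : FZip.{u, v} p K} {i : ℤ} {y z : M.carrier} (h : M.Rel i y z)
    (L : Type w) [Field L] [CharP L p] [Algebra K L] :
    (M.baseChange L).Rel i ((1 : L) ⊗ₜ[K] y) ((1 : L) ⊗ₜ[K] z) := by
  obtain ⟨hy, hz, h⟩ := h
  refine ⟨Submodule.tmul_mem_baseChange_of_mem 1 hy,
    Submodule.tmul_mem_baseChange_of_mem 1 hz, ?_⟩
  have h1 : (Subquot.baseChange L (M.C_succ_le i)).symm
      (Submodule.Quotient.mk ⟨(1 : L) ⊗ₜ[K] y, Submodule.tmul_mem_baseChange_of_mem 1 hy⟩) =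
      (1 : L) ⊗ₜ[K] (Submodule.Quotient.mk ⟨y, hy⟩ : M.grC i) := by
    rw [LinearEquiv.symm_apply_eq, Subquot.baseChange_tmul]
  have h2 : FrobTwist.congr p (Subquot.baseChange L (M.C_succ_le i)).symm (FrobTwist.mk p
      (Submodule.Quotient.mk ⟨(1 : L) ⊗ₜ[K] y, Submodule.tmul_mem_baseChange_of_mem 1 hy⟩)) =
      FrobTwist.mk p ((1 : L) ⊗ₜ[K] (Submodule.Quotient.mk ⟨y, hy⟩ : M.grC i)) := by
    rw [← h1]
    exact FrobTwist.map_mk p _ _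
  have h3 : FrobTwist.baseChange p L
      (FrobTwist.mk p ((1 : L) ⊗ₜ[K] (Submodule.Quotient.mk ⟨y, hy⟩ : M.grC i))) =
      (1 : L) ⊗ₜ[K] FrobTwist.mk p (Submodule.Quotient.mk ⟨y, hy⟩ : M.grC i) := by
    refine (FrobTwist.lift_mk p (FrobTwist.baseChangeAux p L) _).trans ?_
    rw [FrobTwist.baseChangeAux_tmul, one_pow]
  have h4 : LinearEquiv.baseChange K L _ _ (M.φ i)
      ((1 : L) ⊗ₜ[K] FrobTwist.mk p (Submodule.Quotient.mk ⟨y, hy⟩ : M.grC i)) =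
      (1 : L) ⊗ₜ[K] (Submodule.Quotient.mk ⟨z, hz⟩ : M.grD i) := by
    rw [LinearEquiv.baseChange_tmul, h]
  exact (congrArg (fun t => Subquot.baseChange L (M.D_pred_le i)
    (LinearEquiv.baseChange K L _ _ (M.φ i) t))
    ((congrArg (FrobTwist.baseChange p L) h2).trans h3)).trans
    ((congrArg (Subquot.baseChange L (M.D_pred_le i)) h4).trans
      (Subquot.baseChange_tmul L (M.D_pred_le i) 1 _))

theorem mem_setC_sdiff_iff {τ : ℤ →₀ ℕ} (u : Equiv.Perm (Fin (rank τ))) (i : ℤ)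
    (a : Fin (rank τ)) : a ∈ setC τ u i \ setC τ u (i + 1) ↔ u a ∈ blockJ τ i := by
  have := tail_succ τ i
  simp only [setC, Set.mem_sdiff, Set.mem_ofPred_eq, blockJ, this]
  omega

theorem hasType_stdFZip (τ : ℤ →₀ ℕ) (u : Equiv.Perm (Fin (rank τ))) :
    (stdFZip p K τ u).HasType τ := by
  classical
  intro i
  have _ : Fintype ↥(setC τ u i \ setC τ u (i + 1)) := Fintype.ofFinite _
  refine (LinearEquiv.finrank_eq (coordSubquot K (setC τ u i) (setC τ u (i + 1)))).trans ?_
  rw [Module.finrank_fintype_fun_eq_card, ← card_blockJ (τ := τ) i, ← Nat.card_eq_fintype_card]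
  exact Nat.card_congr (u.subtypeEquiv fun a => mem_setC_sdiff_iff u i a)

theorem coordSubquot_mk {ι : Type v} {S T : Set ι} (f : coordSub K S) :
    coordSubquot K S T (Submodule.Quotient.mk f) =
      fun a : ↥(S \ T) => (f : ι → K) a := rfl

theorem single_mem_coordSub {ι : Type v} [DecidableEq ι] {S : Set ι} {a : ι} (ha : a ∈ S) :
    (Pi.single a 1 : ι → K) ∈ coordSub K S := fun b hb =>
  by
  refine Pi.single_eq_of_ne ?_ 1
  rintro rfl
  exact hb ha

theorem rel_stdFZip {τ : ℤ →₀ ℕ} (u : Equiv.Perm (Fin (rank τ))) (a : Fin (rank τ)) :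
    (stdFZip p K τ u).Rel (index τ (u a)) (Pi.single a 1 : Fin (rank τ) → K)
      (Pi.single (x τ (u a)) 1 : Fin (rank τ) → K) := by
  classical
  set i := index τ (u a) with hi
  have ha : a ∈ setC τ u i \ setC τ u (i + 1) :=
    (mem_setC_sdiff_iff u i a).2 (index_spec τ _)
  have hx : x τ (u a) ∈ setD τ i := x_lt τ (u a)
  refine ⟨single_mem_coordSub ha.1, single_mem_coordSub hx, ?_⟩
  let _ : Fintype ↥(setC τ u i \ setC τ u (i + 1)) := Fintype.ofFinite _
  have h1 : FrobTwist.congr p (coordSubquot K (setC τ u i) (setC τ u (i + 1)))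
      (FrobTwist.mk p (Submodule.Quotient.mk
        ⟨(Pi.single a 1 : Fin (rank τ) → K), single_mem_coordSub ha.1⟩)) =
      FrobTwist.mk p (fun b : ↥(setC τ u i \ setC τ u (i + 1)) =>
        (Pi.single a 1 : Fin (rank τ) → K) b) :=
    FrobTwist.map_mk p (coordSubquot K (setC τ u i) (setC τ u (i + 1))).toLinearMap _
  have h2 : FrobTwist.piEquiv p _ (FrobTwist.mk p
      (fun b : ↥(setC τ u i \ setC τ u (i + 1)) => (Pi.single a 1 : Fin (rank τ) → K) b)) =
      fun b : ↥(setC τ u i \ setC τ u (i + 1)) => (Pi.single a 1 : Fin (rank τ) → K) b ^ p :=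
    FrobTwist.lift_mk p _ _
  have h3 : LinearEquiv.funCongrLeft K K (stdEquiv τ u i).symm
      (fun b : ↥(setC τ u i \ setC τ u (i + 1)) => (Pi.single a 1 : Fin (rank τ) → K) b ^ p) =
      coordSubquot K (setD τ i) (setD τ (i - 1)) (Submodule.Quotient.mk
        ⟨(Pi.single (x τ (u a)) 1 : Fin (rank τ) → K), single_mem_coordSub hx⟩) := by
    rw [coordSubquot_mk]
    funext b
    obtain ⟨c, rfl⟩ := (stdEquiv τ u i).surjective b
    have hc : ((stdEquiv τ u i c : ↥(setD τ i \ setD τ (i - 1))) : Fin (rank τ)) = x τ (u c) := rfl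
    rw [LinearEquiv.funCongrLeft_apply, LinearMap.funLeft_apply, Equiv.symm_apply_apply, hc]
    -- The entries are `0` and `1`, so the coordinatewise `p`-th power does not change them.
    simp only [Pi.single_apply, EmbeddingLike.apply_eq_iff_eq]
    split_ifs
    · exact one_pow p
    · exact zero_pow (Fact.out : p.Prime).ne_zero
  exact (LinearEquiv.symm_apply_eq _).2 ((congrArg (LinearEquiv.funCongrLeft K K
    (stdEquiv τ u i).symm) ((congrArg (FrobTwist.piEquiv p _) h1).trans h2)).trans h3)

theorem isStdBasis_baseChange_stdFZip {τ : ℤ →₀ ℕ} (u : Equiv.Perm (Fin (rank τ)))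
    (L : Type w) [Field L] [CharP L p] [Algebra K L] :
    ((stdFZip p K τ u).baseChange L).IsStdBasis u
      ((Pi.basisFun K (Fin (rank τ))).baseChange L) := by
  classical
  have h : ∀ a, (Pi.basisFun K (Fin (rank τ))).baseChange L a =
      (1 : L) ⊗ₜ[K] (Pi.single a 1 : Fin (rank τ) → K) := fun a => by
    rw [Module.Basis.baseChange_apply, Pi.basisFun_apply]
  refine ⟨fun i b hb => ?_, fun a => ?_⟩
  · exact (congrArg (· ∈ ((stdFZip p K τ u).baseChange L).D i) (h b)).mpr
      (Submodule.tmul_mem_baseChange_of_mem 1 (single_mem_coordSub hb))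
  · exact (congrArg₂ (((stdFZip p K τ u).baseChange L).Rel (index τ (u a))) (h a) (h _)).mpr
      ((rel_stdFZip u a).baseChange L)

end Standard

/-- Over an algebraically closed field, every `F`-zip of type `τ` is isomorphic to the standard
`F`-zip of a unique `u ∈ ^J W`. -/
theorem existsUnique_iso_stdFZip {p : ℕ} [Fact p.Prime] {k : Type u} [Field k] [CharP k p]
    [Algebra (ZMod p) k] [IsAlgClosed k] {τ : ℤ →₀ ℕ} (M : FZip.{u, v} p k) (hM : M.HasType τ) :
    ∃! u, u ∈ JW τ ∧ Nonempty (M.Iso ((stdFZip p (ZMod p) τ u).baseChange k)) := by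
  obtain ⟨u, hu, e, he⟩ := M.exists_isStdBasis hM
  refine ⟨u, ⟨hu, he.nonempty_iso hM (isStdBasis_baseChange_stdFZip u k)
    ((hasType_stdFZip τ u).baseChange k)⟩, ?_⟩
  rintro u' ⟨hu', ⟨f⟩⟩
  -- Pulled back along `f`, the basis for `u'` lives on the same `M` as the basis for `u`.
  exact ((isStdBasis_baseChange_stdFZip u' k).map_iso f).perm_unique hM hu' he hu

end FZip

theorem mainTheorem1 (p : ℕ) [Fact p.Prime] (k : Type u) [Field k] [CharP k p]
    [Algebra (ZMod p) k] [IsAlgClosed k] (τ : ℤ →₀ ℕ) :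
    -- the standard zips over the prime field have type `τ`
    (∀ u ∈ ZipType.JW τ, (stdFZip p (ZMod p) τ u).HasType τ) ∧
    -- `u ↦ M^u_τ ⊗ k` is a bijection from `^J W` to the isomorphism classes of type `τ` over `k`
    Set.BijOn (fun u => FZip.isoClass ((stdFZip p (ZMod p) τ u).baseChange k))
      (ZipType.JW τ) (FZip.isoClassesOfType.{u, u} p k τ) ∧
    -- `u ↦ W_J u` is a bijection from `^J W` to `W_J \ S_n`
    Set.BijOn (fun u => (Quotient.mk (QuotientGroup.rightRel (ZipType.WJ τ)) u))
      (ZipType.JW τ) Set.univ ∧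
    -- every zip of type `τ` is isomorphic to `M^u_τ ⊗ k` for a unique `u ∈ ^J W`
    (∀ M : FZip.{u, v} p k, M.HasType τ →
      ∃! u, u ∈ ZipType.JW τ ∧ Nonempty (M.Iso ((stdFZip p (ZMod p) τ u).baseChange k))) := by
  refine ⟨fun u _ => FZip.hasType_stdFZip τ u, ⟨fun u _ => ?_, fun u hu u' hu' h => ?_, ?_⟩,
    ZipType.bijOn_mk_JW, fun M hM => M.existsUnique_iso_stdFZip hM⟩
  · exact ⟨_, (FZip.hasType_stdFZip τ u).baseChange k, rfl⟩
  -- Injectivity is the uniqueness statement for the standard zip of `u` itself, isomorphic to those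
  -- of `u` and `u'`.
  · exact (FZip.existsUnique_iso_stdFZip _ ((FZip.hasType_stdFZip τ u).baseChange k)).unique
      ⟨hu, ⟨FZip.Iso.refl _⟩⟩ ⟨hu', Quotient.exact h⟩
  · rintro _ ⟨M, hM, rfl⟩
    obtain ⟨u, ⟨hu, ⟨f⟩⟩, -⟩ := M.existsUnique_iso_stdFZip hM
    exact ⟨u, hu, Quotient.sound ⟨f.symm⟩⟩
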